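/- **Theorem 5.1 (Evolution of the Riemann curvature tensor).** Let $M$ be a smooth $n$-dimensional manifold and let $(g(t),A(t),B(t))$, $t\in[0,T)$, be a smooth family of Riemannian metrics, one-forms and two-forms on $M$. Put $F=dA$ and $H=dB$, that is $F_{ij}=\partial_iA_j-\partial_jA_i$ and $H_{ijk}=\partial_iB_{jk}+\partial_jB_{ki}+\partial_kB_{ij}$. Suppose that in local coordinates $$\frac{\partial g_{ij}}{\partial t}=-2\Big[R_{ij}-\tfrac14H_{ikl}H_j{}^{kl}-F_i{}^{k}F_{jk}\Big],\qquad \frac{\partial A_i}{\partial t}=-\nabla_kF_i{}^{k},\qquad \frac{\partial B_{ij}}{\partial t}=\nabla_kH^{k}{}_{ij}. \tag{21}$$ Here indices are raised with $g(t)$, $\nabla$ is the Levi-Civita connection of $g(t)$ with Christoffel symbols $\Gamma^k_{ij}$, and the conventions for the curvature are $$R^{k}_{ijl}=\partial_i\Gamma^{k}_{jl}-\partial_j\Gamma^{k}_{il}+\Gamma^{k}_{ip}\Gamma^{p}_{jl}-\Gamma^{k}_{jp}\Gamma^{p}_{il},\qquad R_{ijkl}=g_{kp}R^{p}_{ijl},\qquad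 R_{ik}=g^{jl}R_{ijkl}.$$ Then at every point of $M$ and every $t\in[0,T)$ (with the one-sided time derivative at $t=0$), in all local coordinates, the curvature tensor satisfies $$\begin{aligned} \frac{\partial}{\partial t}R_{ijkl}={}&\Delta R_{ijkl}+2(B_{ijkl}-B_{ijlk}-B_{iljk}+B_{ikjl})\\ &-g^{pq}(R_{pjkl}R_{qi}+R_{ipkl}R_{qj}+R_{ijpl}R_{qk}+R_{ijkp}R_{ql})\\ &+\tfrac14\big[\nabla_i\nabla_l(H_{kpq}H_j{}^{pq})-\nabla_i\nabla_k(H_{jpq}H_l{}^{pq})-\nabla_j\nabla_l(H_{kpq}H_i{}^{pq})+\nabla_j\nabla_k(H_{ipq}H_l{}^{pq})\big]\\ &+\tfrac14g^{mn}\big(H_{kpq}H_m{}^{pq}R_{ijnl}+H_{mpq}H_l{}^{pq}R_{ijkn}\big)\\ &+\nabla_i\nabla_l(F_k{}^{p}F_{jp})-\nabla_i\nabla_k(F_j{}^{p}F_{lp})-\nabla_j\nabla_l(F_k{}^{p}F_{ip})+\nabla_j\nabla_k(F_i{}^{p}F_{lp})\\ &+g^{mn}\big(F_k{}^{p}F_{mp}R_{ijnl}+F_m{}^{p}F_{lp}R_{ijkn}\big),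 \end{aligned}$$ where $B_{ijkl}=g^{pr}g^{qs}R_{piqj}R_{rksl}$ (four indices, not to be confused with the two-form $B_{ij}$) and $\Delta=g^{pq}\nabla_p\nabla_q$ is the Laplacian of the evolving metric. -/

import Mathlib

open scoped Manifold ContDiff

noncomputable section

namespace GenRicciFlow

/-! ### Tensor calculus in local coordinates

Coordinates `y` range over (an open subset of) `EuclideanSpace ℝ (Fin n)`. -/

/-- The components, in local coordinates, of a covariant tensor field of rank `r`:
`S ![i₁, …, iᵣ] y` is the component `S_{i₁ … iᵣ}` at the point with coordinates `y`. -/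
abbrev Tensor (n r : ℕ) : Type :=
  (Fin r → Fin n) → EuclideanSpace ℝ (Fin n) → ℝ

variable {n r : ℕ}

/-- The partial derivative `∂f/∂yⁱ`. -/
def partialDeriv (i : Fin n) (f : EuclideanSpace ℝ (Fin n) → ℝ)
    (y : EuclideanSpace ℝ (Fin n)) : ℝ :=
  fderiv ℝ f y (EuclideanSpace.single i 1)

/-- The components `g^{ij}` of the inverse of the metric. -/
def inv (g : Tensor n 2) (i j : Fin n) (y : EuclideanSpace ℝ (Fin n)) : ℝ :=
  (Matrix.of fun a b => g ![a, b] y)⁻¹ i j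

/-- The Christoffel symbols
`Γ^k_{ij} = ½ g^{kl} (∂_i g_{jl} + ∂_j g_{il} - ∂_l g_{ij})`. -/
def christoffel (g : Tensor n 2) (k i j : Fin n) (y : EuclideanSpace ℝ (Fin n)) : ℝ :=
  (1 / 2) * ∑ l, inv g k l y *
    (partialDeriv i (g ![j, l]) y + partialDeriv j (g ![i, l]) y - partialDeriv l (g ![i, j]) y)

/-- The curvature components
`R^k_{ijl} = ∂_i Γ^k_{jl} - ∂_j Γ^k_{il} + Γ^k_{ip} Γ^p_{jl} - Γ^k_{jp} Γ^p_{il}`. -/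
def riemannUp (g : Tensor n 2) (k i j l : Fin n) (y : EuclideanSpace ℝ (Fin n)) : ℝ :=
  partialDeriv i (christoffel g k j l) y - partialDeriv j (christoffel g k i l) y
    + ∑ p, (christoffel g k i p y * christoffel g p j l y
      - christoffel g k j p y * christoffel g p i l y)

/-- The Riemann curvature tensor `R_{ijkl} = g_{kp} R^p_{ijl}`. -/
def riemann (g : Tensor n 2) : Tensor n 4 := fun I y =>
  ∑ p, g ![I 2, p] y * riemannUp g p (I 0) (I 1) (I 3) y

/-- The Ricci tensor `R_{ik} = g^{jl} R_{ijkl}`. -/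
def ricci (g : Tensor n 2) : Tensor n 2 := fun I y =>
  ∑ j, ∑ l, inv g j l y * riemann g ![I 0, j, I 1, l] y

/-- The Levi-Civita covariant derivative of a covariant tensor; the derivative index comes first:
`∇_m S_{i₁…iᵣ} = ∂_m S_{i₁…iᵣ} - ∑ₛ Γ^p_{m iₛ} S_{i₁…p…iᵣ}` (`p` in the place of `iₛ`).
Hence `cov g (cov g S) ![i, j, …]` is `∇_i ∇_j S_{…}`. -/
def cov (g : Tensor n 2) (S : Tensor n r) : Tensor n (r + 1) := fun I y =>
  partialDeriv (I 0) (S (Fin.tail I)) y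
    - ∑ s, ∑ p, christoffel g p (I 0) (Fin.tail I s) y * S (Function.update (Fin.tail I) s p) y

/-- The (rough) Laplacian `Δ S = g^{pq} ∇_p ∇_q S`. -/
def laplacian (g : Tensor n 2) (S : Tensor n r) : Tensor n r := fun I y =>
  ∑ p, ∑ q, inv g p q y * cov g (cov g S) (Fin.cons p (Fin.cons q I)) y

/-- The quadratic curvature expression `B_{ijkl} = g^{pr} g^{qs} R_{piqj} R_{rksl}`. -/
def quadB (g : Tensor n 2) : Tensor n 4 := fun I y =>
  ∑ p, ∑ q, ∑ r, ∑ s, inv g p r y * inv g q s y *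
    riemann g ![p, I 0, q, I 1] y * riemann g ![r, I 2, s, I 3] y

/-- `F = dA`, that is `F_{ij} = ∂_i A_j - ∂_j A_i`. -/
def fieldF (A : Tensor n 1) : Tensor n 2 := fun I y =>
  partialDeriv (I 0) (A ![I 1]) y - partialDeriv (I 1) (A ![I 0]) y

/-- `H = dB`, that is `H_{ijk} = ∂_i B_{jk} + ∂_j B_{ki} + ∂_k B_{ij}`. -/
def fieldH (B : Tensor n 2) : Tensor n 3 := fun I y =>
  partialDeriv (I 0) (B ![I 1, I 2]) y + partialDeriv (I 1) (B ![I 2, I 0]) y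
    + partialDeriv (I 2) (B ![I 0, I 1]) y

/-- The symmetric tensor `F_i^k F_{jk} = g^{kl} F_{il} F_{jk}`. -/
def sqF (g : Tensor n 2) (A : Tensor n 1) : Tensor n 2 := fun I y =>
  ∑ k, ∑ l, inv g k l y * fieldF A ![I 0, l] y * fieldF A ![I 1, k] y

/-- The symmetric tensor `H_{ikl} H_j^{kl} = g^{kp} g^{lq} H_{ikl} H_{jpq}`. -/
def sqH (g : Tensor n 2) (B : Tensor n 2) : Tensor n 2 := fun I y =>
  ∑ k, ∑ l, ∑ p, ∑ q, inv g k p y * inv g l q y *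
    fieldH B ![I 0, k, l] y * fieldH B ![I 1, p, q] y

/-- `∇_k F_i^k = g^{kl} ∇_k F_{il}`. -/
def divF (g : Tensor n 2) (A : Tensor n 1) : Tensor n 1 := fun I y =>
  ∑ k, ∑ l, inv g k l y * cov g (fieldF A) ![k, I 0, l] y

/-- `∇_k H^k_{ij} = g^{kl} ∇_k H_{lij}`. -/
def divH (g : Tensor n 2) (B : Tensor n 2) : Tensor n 2 := fun I y =>
  ∑ k, ∑ l, inv g k l y * cov g (fieldH B) ![k, l, I 0, I 1] y

/-! ### Tensor fields on a manifold and their components in a chart -/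

variable {M : Type*} [TopologicalSpace M] [ChartedSpace (EuclideanSpace ℝ (Fin n)) M]

/-- The coordinate vector field `∂/∂yⁱ` of the chart `φ`, at the point with coordinates `y`. -/
def coordVec (φ : OpenPartialHomeomorph M (EuclideanSpace ℝ (Fin n))) (i : Fin n)
    (y : EuclideanSpace ℝ (Fin n)) : TangentSpace (𝓡 n) (φ.symm y) :=
  mfderiv 𝓘(ℝ, EuclideanSpace ℝ (Fin n)) (𝓡 n) φ.symm y (EuclideanSpace.single i (1 : ℝ))

/-- A field of bilinear forms on the tangent spaces of `M`. -/
abbrev BilinField (n : ℕ) (M : Type*) [TopologicalSpace M]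
    [ChartedSpace (EuclideanSpace ℝ (Fin n)) M] : Type _ :=
  (x : M) → TangentSpace (𝓡 n) x →L[ℝ] TangentSpace (𝓡 n) x →L[ℝ] ℝ

/-- A field of alternating `k`-forms on the tangent spaces of `M`. -/
abbrev FormField (n k : ℕ) (M : Type*) [TopologicalSpace M]
    [ChartedSpace (EuclideanSpace ℝ (Fin n)) M] : Type _ :=
  (x : M) → TangentSpace (𝓡 n) x [⋀^Fin k]→L[ℝ] ℝ

/-- The components of a field of bilinear forms in the chart `φ`. -/
def bilinComp (φ : OpenPartialHomeomorph M (EuclideanSpace ℝ (Fin n)))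
    (g : BilinField n M) : Tensor n 2 := fun I y =>
  g (φ.symm y) (coordVec φ (I 0) y) (coordVec φ (I 1) y)

/-- The components of a field of alternating forms in the chart `φ`. -/
def formComp {k : ℕ} (φ : OpenPartialHomeomorph M (EuclideanSpace ℝ (Fin n)))
    (α : FormField n k M) : Tensor n k := fun I y =>
  α (φ.symm y) fun s => coordVec φ (I s) y

/-- The time-dependent tensor field with components `S t` in the chart `φ` is smooth on
`[0, T) × φ.target` (with one-sided time derivatives at `0`). -/
def SmoothComp (φ : OpenPartialHomeomorph M (EuclideanSpace ℝ (Fin n))) (T : ℝ)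
    (S : ℝ → Tensor n r) : Prop :=
  ∀ I, ContDiffOn ℝ ∞ (fun p : ℝ × EuclideanSpace ℝ (Fin n) => S p.1 I p.2)
    (Set.Ico 0 T ×ˢ φ.target)

/-- `(g, A, B)` is a smooth solution on `M × [0, T)` of the generalized Ricci flow:
`g t` is a Riemannian metric, `A t` a one-form and `B t` a two-form, all smooth in space and time,
and with `F = dA`, `H = dB` the following hold in all local coordinates of the smooth structure:
`∂_t g_{ij} = -2 (R_{ij} - ¼ H_{ikl} H_j^{kl} - F_i^k F_{jk})`,
`∂_t A_i = -∇_k F_i^k`, `∂_t B_{ij} = ∇_k H^k_{ij}`. -/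
structure IsSolution (T : ℝ) (g : ℝ → BilinField n M) (A : ℝ → FormField n 1 M)
    (B : ℝ → FormField n 2 M) : Prop where
  symm : ∀ t ∈ Set.Ico 0 T, ∀ (x : M) (v w : TangentSpace (𝓡 n) x), g t x v w = g t x w v
  pos : ∀ t ∈ Set.Ico 0 T, ∀ (x : M) (v : TangentSpace (𝓡 n) x), v ≠ 0 → 0 < g t x v v
  smooth_g : ∀ φ ∈ IsManifold.maximalAtlas (𝓡 n) ∞ M,
    SmoothComp φ T fun t => bilinComp φ (g t)
  smooth_A : ∀ φ ∈ IsManifold.maximalAtlas (𝓡 n) ∞ M,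
    SmoothComp φ T fun t => formComp φ (A t)
  smooth_B : ∀ φ ∈ IsManifold.maximalAtlas (𝓡 n) ∞ M,
    SmoothComp φ T fun t => formComp φ (B t)
  flow_g : ∀ φ ∈ IsManifold.maximalAtlas (𝓡 n) ∞ M, ∀ t ∈ Set.Ico 0 T, ∀ y ∈ φ.target,
    ∀ i j : Fin n,
      HasDerivWithinAt (fun s => bilinComp φ (g s) ![i, j] y)
        (-2 * (ricci (bilinComp φ (g t)) ![i, j] y
          - (1 / 4) * sqH (bilinComp φ (g t)) (formComp φ (B t)) ![i, j] y
          - sqF (bilinComp φ (g t)) (formComp φ (A t)) ![i, j] y))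
        (Set.Ico 0 T) t
  flow_A : ∀ φ ∈ IsManifold.maximalAtlas (𝓡 n) ∞ M, ∀ t ∈ Set.Ico 0 T, ∀ y ∈ φ.target,
    ∀ i : Fin n,
      HasDerivWithinAt (fun s => formComp φ (A s) ![i] y)
        (-divF (bilinComp φ (g t)) (formComp φ (A t)) ![i] y) (Set.Ico 0 T) t
  flow_B : ∀ φ ∈ IsManifold.maximalAtlas (𝓡 n) ∞ M, ∀ t ∈ Set.Ico 0 T, ∀ y ∈ φ.target,
    ∀ i j : Fin n,
      HasDerivWithinAt (fun s => formComp φ (B s) ![i, j] y)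
        (divH (bilinComp φ (g t)) (formComp φ (B t)) ![i, j] y) (Set.Ico 0 T) t

/-- The right-hand side of the evolution equation of `R_{ijkl}`, for the metric components `g`,
the symmetric tensors `hh = H_{ipq} H_j^{pq}` and `ff = F_i^p F_{jp}`. -/
def evolutionRHS (g hh ff : Tensor n 2) (i j k l : Fin n)
    (y : EuclideanSpace ℝ (Fin n)) : ℝ :=
  laplacian g (riemann g) ![i, j, k, l] y
    + 2 * (quadB g ![i, j, k, l] y - quadB g ![i, j, l, k] y
        - quadB g ![i, l, j, k] y + quadB g ![i, k, j, l] y)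
    - ∑ p, ∑ q, inv g p q y *
        (riemann g ![p, j, k, l] y * ricci g ![q, i] y
          + riemann g ![i, p, k, l] y * ricci g ![q, j] y
          + riemann g ![i, j, p, l] y * ricci g ![q, k] y
          + riemann g ![i, j, k, p] y * ricci g ![q, l] y)
    + (1 / 4) * (cov g (cov g hh) ![i, l, k, j] y - cov g (cov g hh) ![i, k, j, l] y
        - cov g (cov g hh) ![j, l, k, i] y + cov g (cov g hh) ![j, k, i, l] y)
    + (1 / 4) * ∑ m, ∑ q, inv g m q y *
        (hh ![k, m] y * riemann g ![i, j, q, l] y + hh ![m, l] y * riemann g ![i, j, k, q] y)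
    + (cov g (cov g ff) ![i, l, k, j] y - cov g (cov g ff) ![i, k, j, l] y
        - cov g (cov g ff) ![j, l, k, i] y + cov g (cov g ff) ![j, k, i, l] y)
    + ∑ m, ∑ q, inv g m q y *
        (ff ![k, m] y * riemann g ![i, j, q, l] y + ff ![m, l] y * riemann g ![i, j, k, q] y)

end GenRicciFlow

end

/-!
The evolution equation follows from two identities of tensor calculus on an open set of coordinates.

*Variation of the curvature.* If `∂_t g = h`, then differentiating the formula for the Christoffel
symbols of the first kind gives `g_{kp} ∂_t Γ^p_{jl} = ½ (∇_j h_{lk} + ∇_l h_{kj} - ∇_k h_{jl})`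
(`lowerConnDeriv_eq`), and the lowered time derivative of `R^k_{ijl}` is the antisymmetrization in
`i, j` of the covariant derivative of this tensor (`cov_lowerConnDeriv_sub`). One pair of the six
second derivatives of `h` forms a commutator, and the Ricci identity turns it into terms
`h * Rm` (`hasDerivWithinAt_riemann`). Time and space derivatives may be interchanged, also at
`t = 0`, because every point of `[0, T) × U` is in the closure of its interior
(`SmoothInTime.timeDeriv_partialDeriv`).

*Hamilton's formula for `Δ Rm`.* The second Bianchi identity writes `∇_p ∇_q R_{ijkl}` through
`∇_p ∇_i R_{qjkl}` and `∇_p ∇_j R_{qikl}`. Interchanging the two derivatives produces quadratic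
curvature terms, which the first Bianchi identity and the pair symmetry express by `B_{ijkl}` and
the Ricci tensor; the remaining divergence of the curvature is given by the contracted second
Bianchi identity (`IsMetricOn.laplacian_riemann`).

The variation formula is linear in `h = -2 Ric + ½ H² + 2 F²`. The `H²` and `F²` parts are the
terms of the evolution equation as they stand, and Hamilton's formula rewrites the Ricci part
(`variation_eq_evolutionRHS`).

Two devices keep the index calculus manageable. The connection terms of a covariant derivative and
the curvature terms of the Ricci identity are both given by the action `act` of a matrix on the
slots of a tensor; the Ricci identity then is the commutation rule `act_commutator`, and the second
Bianchi identity the Jacobi identity for the operators `∂_i + Γ_i`. Symmetries of a tensor pass to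
its covariant derivatives because these commute with permutations of the slots (`cov_permSlots`).
-/

noncomputable section
namespace GenRicciFlow
variable {n r : ℕ}

/-! ### Calculus of partial derivatives -/

lemma partialDeriv_congr_on {U : Set (EuclideanSpace ℝ (Fin n))} (hU : IsOpen U)
    {f f' : EuclideanSpace ℝ (Fin n) → ℝ} (h : ∀ y ∈ U, f y = f' y) (i : Fin n)
    {y : EuclideanSpace ℝ (Fin n)} (hy : y ∈ U) :
    partialDeriv i f y = partialDeriv i f' y := by
  have : f =ᶠ[nhds y] f' := Filter.eventually_of_mem (hU.mem_nhds hy) h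
  rw [partialDeriv, partialDeriv, this.fderiv_eq]

lemma partialDeriv_add {f f' : EuclideanSpace ℝ (Fin n) → ℝ} {y : EuclideanSpace ℝ (Fin n)}
    (hf : DifferentiableAt ℝ f y) (hf' : DifferentiableAt ℝ f' y) (i : Fin n) :
    partialDeriv i (fun y => f y + f' y) y = partialDeriv i f y + partialDeriv i f' y := by
  simp [partialDeriv, fderiv_fun_add hf hf']

lemma partialDeriv_sub {f f' : EuclideanSpace ℝ (Fin n) → ℝ} {y : EuclideanSpace ℝ (Fin n)}
    (hf : DifferentiableAt ℝ f y) (hf' : DifferentiableAt ℝ f' y) (i : Fin n) :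
    partialDeriv i (fun y => f y - f' y) y = partialDeriv i f y - partialDeriv i f' y := by
  simp [partialDeriv, fderiv_fun_sub hf hf']

lemma partialDeriv_mul {f f' : EuclideanSpace ℝ (Fin n) → ℝ} {y : EuclideanSpace ℝ (Fin n)}
    (hf : DifferentiableAt ℝ f y) (hf' : DifferentiableAt ℝ f' y) (i : Fin n) :
    partialDeriv i (fun y => f y * f' y) y
      = partialDeriv i f y * f' y + f y * partialDeriv i f' y := by
  simp [partialDeriv, fderiv_fun_mul hf hf']; ring

lemma partialDeriv_const_mul {f : EuclideanSpace ℝ (Fin n) → ℝ} {y : EuclideanSpace ℝ (Fin n)}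
    (hf : DifferentiableAt ℝ f y) (c : ℝ) (i : Fin n) :
    partialDeriv i (fun y => c * f y) y = c * partialDeriv i f y := by
  simp [partialDeriv, fderiv_const_mul hf]

lemma partialDeriv_const (c : ℝ) (i : Fin n) (y : EuclideanSpace ℝ (Fin n)) :
    partialDeriv i (fun _ => c) y = 0 := by
  simp [partialDeriv]

lemma partialDeriv_sum {ι : Type*} (s : Finset ι) {f : ι → EuclideanSpace ℝ (Fin n) → ℝ}
    {y : EuclideanSpace ℝ (Fin n)} (hf : ∀ a ∈ s, DifferentiableAt ℝ (f a) y) (i : Fin n) :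
    partialDeriv i (fun y => ∑ a ∈ s, f a y) y = ∑ a ∈ s, partialDeriv i (f a) y := by
  simp [partialDeriv, fderiv_fun_sum hf]

lemma differentiableAt_of_smoothOn {U : Set (EuclideanSpace ℝ (Fin n))} (hU : IsOpen U)
    {f : EuclideanSpace ℝ (Fin n) → ℝ} (hf : ContDiffOn ℝ ∞ f U)
    {y : EuclideanSpace ℝ (Fin n)} (hy : y ∈ U) : DifferentiableAt ℝ f y :=
  (hf.contDiffAt (hU.mem_nhds hy)).differentiableAt (by simp)

lemma contDiffOn_partialDeriv {U : Set (EuclideanSpace ℝ (Fin n))} (hU : IsOpen U)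
    {f : EuclideanSpace ℝ (Fin n) → ℝ} (hf : ContDiffOn ℝ ∞ f U) (i : Fin n) :
    ContDiffOn ℝ ∞ (partialDeriv i f) U :=
  (hf.fderiv_of_isOpen hU (by simp)).clm_apply contDiffOn_const

lemma partialDeriv_comm {U : Set (EuclideanSpace ℝ (Fin n))} (hU : IsOpen U)
    {f : EuclideanSpace ℝ (Fin n) → ℝ} (hf : ContDiffOn ℝ ∞ f U)
    {y : EuclideanSpace ℝ (Fin n)} (hy : y ∈ U) (i j : Fin n) :
    partialDeriv i (partialDeriv j f) y = partialDeriv j (partialDeriv i f) y := by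
  have hs : IsSymmSndFDerivAt ℝ f y :=
    (hf.contDiffAt (hU.mem_nhds hy)).isSymmSndFDerivAt (by
      rw [minSmoothness_of_isRCLikeNormedField]
      exact WithTop.coe_le_coe.2 (le_top : (2 : ℕ∞) ≤ ⊤))
  have hd : DifferentiableAt ℝ (fderiv ℝ f) y :=
    ((hf.fderiv_of_isOpen hU (m := ∞) (by simp)).contDiffAt
      (hU.mem_nhds hy)).differentiableAt (by simp)
  have key : ∀ a b : Fin n, partialDeriv a (partialDeriv b f) y
      = fderiv ℝ (fderiv ℝ f) y (EuclideanSpace.single a 1) (EuclideanSpace.single b 1) := by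
    intro a b
    have : HasFDerivAt (partialDeriv b f) ((fderiv ℝ (fderiv ℝ f) y).flip
        (EuclideanSpace.single b 1)) y := by
      have h := hd.hasFDerivAt.clm_apply
        (hasFDerivAt_const (EuclideanSpace.single b (1 : ℝ)) y)
      rw [ContinuousLinearMap.comp_zero, zero_add] at h
      exact h
    rw [partialDeriv, this.fderiv]; rfl
  rw [key, key, hs.eq]

/-- The entries of the inverse of a smooth family of invertible matrices are smooth, since they
are the quotients of cofactors by the determinant. -/
lemma contDiffOn_matrix_inv {V : Type*} [NormedAddCommGroup V] [NormedSpace ℝ V] {s : Set V}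
    {m : V → Matrix (Fin n) (Fin n) ℝ} (hm : ∀ i j, ContDiffOn ℝ ∞ (fun x => m x i j) s)
    (hdet : ∀ x ∈ s, (m x).det ≠ 0) (i j : Fin n) :
    ContDiffOn ℝ ∞ (fun x => (m x)⁻¹ i j) s := by
  have det_smooth : ∀ m : V → Matrix (Fin n) (Fin n) ℝ,
      (∀ i j, ContDiffOn ℝ ∞ (fun x => m x i j) s) → ContDiffOn ℝ ∞ (fun x => (m x).det) s := by
    intro m hm
    simp only [Matrix.det_apply]
    exact ContDiffOn.sum fun σ _ => (contDiffOn_prod fun i _ => hm _ _).const_smul _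
  have h : ∀ x, (m x)⁻¹ i j = ((m x).det)⁻¹ * (m x).adjugate i j := fun x => by
    simp [Matrix.inv_def]
  simp only [h]
  refine ((det_smooth m hm).inv hdet).mul ?_
  simp only [Matrix.adjugate_apply]
  refine det_smooth _ fun a b => ?_
  by_cases hab : a = j
  · subst hab
    simpa using contDiffOn_const
  · simpa [Matrix.updateRow_ne hab] using hm a b

/-- The partial derivative, entry by entry, of a matrix-valued function. -/
def matrixDeriv (i : Fin n) (m : EuclideanSpace ℝ (Fin n) → Matrix (Fin n) (Fin n) ℝ)
    (y : EuclideanSpace ℝ (Fin n)) : Matrix (Fin n) (Fin n) ℝ :=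
  Matrix.of fun a b => partialDeriv i (fun z => m z a b) y

lemma matrixDeriv_mul {m m' : EuclideanSpace ℝ (Fin n) → Matrix (Fin n) (Fin n) ℝ}
    {y : EuclideanSpace ℝ (Fin n)} (hm : ∀ a b, DifferentiableAt ℝ (fun z => m z a b) y)
    (hm' : ∀ a b, DifferentiableAt ℝ (fun z => m' z a b) y) (i : Fin n) :
    matrixDeriv i (fun z => m z * m' z) y
      = matrixDeriv i m y * m' y + m y * matrixDeriv i m' y := by
  ext a b
  simp only [matrixDeriv, Matrix.mul_apply, Matrix.of_apply, Matrix.add_apply]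
  refine (partialDeriv_sum _ (fun c _ => (hm a c).mul (hm' c b)) i).trans ?_
  rw [← Finset.sum_add_distrib]
  exact Finset.sum_congr rfl fun c _ => partialDeriv_mul (hm a c) (hm' c b) i

lemma matrixDeriv_add {m m' : EuclideanSpace ℝ (Fin n) → Matrix (Fin n) (Fin n) ℝ}
    {y : EuclideanSpace ℝ (Fin n)} (hm : ∀ a b, DifferentiableAt ℝ (fun z => m z a b) y)
    (hm' : ∀ a b, DifferentiableAt ℝ (fun z => m' z a b) y) (i : Fin n) :
    matrixDeriv i (fun z => m z + m' z) y = matrixDeriv i m y + matrixDeriv i m' y := by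
  ext a b
  exact partialDeriv_add (hm a b) (hm' a b) i

lemma matrixDeriv_sub {m m' : EuclideanSpace ℝ (Fin n) → Matrix (Fin n) (Fin n) ℝ}
    {y : EuclideanSpace ℝ (Fin n)} (hm : ∀ a b, DifferentiableAt ℝ (fun z => m z a b) y)
    (hm' : ∀ a b, DifferentiableAt ℝ (fun z => m' z a b) y) (i : Fin n) :
    matrixDeriv i (fun z => m z - m' z) y = matrixDeriv i m y - matrixDeriv i m' y := by
  ext a b
  exact partialDeriv_sub (hm a b) (hm' a b) i

/-! ### Matrices acting on the slots of a tensor -/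

/-- The derivation action of a matrix `M` on a covariant array: the sum over the slots `s` of
`M^p_{iₛ} S_{i₁…p…iᵣ}`. Both the connection terms of `cov` and the curvature terms of the Ricci
identity are of this form. -/
def act (M : Matrix (Fin n) (Fin n) ℝ) (S : (Fin r → Fin n) → ℝ) (I : Fin r → Fin n) : ℝ :=
  ∑ s, ∑ p, M p (I s) * S (Function.update I s p)

lemma act_cons (M : Matrix (Fin n) (Fin n) ℝ) (S : (Fin (r + 1) → Fin n) → ℝ) (a : Fin n)
    (I : Fin r → Fin n) :
    act M S (Matrix.vecCons a I)
      = ∑ p, M p a * S (Matrix.vecCons p I) + act M (fun J => S (Matrix.vecCons a J)) I := by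
  simp only [act, Fin.sum_univ_succ, Matrix.vecCons, Fin.cons_zero, Fin.cons_succ,
    Fin.update_cons_zero, Fin.cons_update]

lemma act_empty (M : Matrix (Fin n) (Fin n) ℝ) (S : (Fin 0 → Fin n) → ℝ) (I : Fin 0 → Fin n) :
    act M S I = 0 := by
  simp [act]

lemma act_add (M : Matrix (Fin n) (Fin n) ℝ) (S S' : (Fin r → Fin n) → ℝ) (I : Fin r → Fin n) :
    act M (fun J => S J + S' J) I = act M S I + act M S' I := by
  simp only [act, mul_add, Finset.sum_add_distrib]

lemma act_sub (M : Matrix (Fin n) (Fin n) ℝ) (S S' : (Fin r → Fin n) → ℝ) (I : Fin r → Fin n) :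
    act M (fun J => S J - S' J) I = act M S I - act M S' I := by
  simp only [act, mul_sub, Finset.sum_sub_distrib]

lemma act_const_mul (M : Matrix (Fin n) (Fin n) ℝ) (c : ℝ) (S : (Fin r → Fin n) → ℝ)
    (I : Fin r → Fin n) : act M (fun J => c * S J) I = c * act M S I := by
  simp only [act, Finset.mul_sum]
  exact Finset.sum_congr rfl fun _ _ => Finset.sum_congr rfl fun _ _ => by ring

lemma act_sum {ι : Type*} (s : Finset ι) (M : Matrix (Fin n) (Fin n) ℝ)
    (S : ι → (Fin r → Fin n) → ℝ) (I : Fin r → Fin n) :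
    act M (fun J => ∑ a ∈ s, S a J) I = ∑ a ∈ s, act M (S a) I := by
  classical
  induction s using Finset.induction_on with
  | empty => simp [act]
  | insert a s ha ih => simp only [Finset.sum_insert ha, act_add, ih]

lemma act_matrix_sub (M N : Matrix (Fin n) (Fin n) ℝ) (S : (Fin r → Fin n) → ℝ)
    (I : Fin r → Fin n) : act (M - N) S I = act M S I - act N S I := by
  simp only [act, Matrix.sub_apply, sub_mul, Finset.sum_sub_distrib]

lemma act_matrix_add (M N : Matrix (Fin n) (Fin n) ℝ) (S : (Fin r → Fin n) → ℝ)
    (I : Fin r → Fin n) : act (M + N) S I = act M S I + act N S I := by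
  simp only [act, Matrix.add_apply, add_mul, Finset.sum_add_distrib]

/-- Matrices act contravariantly on covariant arrays. -/
lemma act_commutator (M N : Matrix (Fin n) (Fin n) ℝ) (S : (Fin r → Fin n) → ℝ)
    (I : Fin r → Fin n) :
    act M (act N S) I - act N (act M S) I = act (N * M - M * N) S I := by
  -- The two matrices act independently on different slots, and by composition on the same slot.
  have key : ∀ M N : Matrix (Fin n) (Fin n) ℝ, act M (act N S) I
      = act (N * M) S I + ∑ s, ∑ s', if s = s' then 0 else
        ∑ p, ∑ q, M p (I s) * N q (I s') *
          S (Function.update (Function.update I s p) s' q) := by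
    intro M N
    rw [act, act, ← Finset.sum_add_distrib]
    refine Finset.sum_congr rfl fun s _ => ?_
    have h : ∀ s', (∑ p, M p (I s) * ∑ q, N q (Function.update I s p s') *
        S (Function.update (Function.update I s p) s' q))
        = (if s' = s then ∑ q, (N * M) q (I s) * S (Function.update I s q) else 0)
          + (if s = s' then 0 else ∑ p, ∑ q, M p (I s) * N q (I s') *
            S (Function.update (Function.update I s p) s' q)) := by
      intro s'
      by_cases hs : s = s'
      · subst hs
        simp only [Function.update_self, Function.update_idem, if_true, add_zero,
          Matrix.mul_apply, Finset.mul_sum, Finset.sum_mul]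
        rw [Finset.sum_comm]
        exact Finset.sum_congr rfl fun _ _ => Finset.sum_congr rfl fun _ _ => by ring
      · simp only [hs, Ne.symm hs, if_false, zero_add, Finset.mul_sum,
          Function.update_of_ne (Ne.symm hs)]
        exact Finset.sum_congr rfl fun _ _ => Finset.sum_congr rfl fun _ _ => by ring
    simp only [act, Finset.mul_sum]
    simp only [Finset.mul_sum] at h
    rw [Finset.sum_comm, Finset.sum_congr rfl fun s' _ => h s', Finset.sum_add_distrib]
    simp
  rw [key M N, key N M, act_matrix_sub]
  have hsymm : (∑ s, ∑ s', if s = s' then 0 else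
        ∑ p, ∑ q, M p (I s) * N q (I s') *
          S (Function.update (Function.update I s p) s' q))
      = ∑ s, ∑ s', if s = s' then 0 else
        ∑ p, ∑ q, N p (I s) * M q (I s') *
          S (Function.update (Function.update I s p) s' q) := by
    rw [Finset.sum_comm]
    refine Finset.sum_congr rfl fun s _ => Finset.sum_congr rfl fun s' _ => ?_
    by_cases hs : s = s'
    · simp [hs]
    · simp only [hs, Ne.symm hs, if_false]
      rw [Finset.sum_comm]
      refine Finset.sum_congr rfl fun p _ => Finset.sum_congr rfl fun q _ => ?_
      rw [Function.update_comm (Ne.symm hs)]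
      ring
  rw [hsymm]
  ring

/-- Permuting the slots of an array commutes with the action of a matrix. -/
lemma act_comp_perm (M : Matrix (Fin n) (Fin n) ℝ) (S : (Fin r → Fin n) → ℝ)
    (σ : Equiv.Perm (Fin r)) (I : Fin r → Fin n) :
    act M (fun J => S (J ∘ σ)) I = act M S (I ∘ σ) := by
  rw [act, act, ← Equiv.sum_comp σ]
  refine Finset.sum_congr rfl fun s _ => Finset.sum_congr rfl fun p _ => ?_
  have : Function.update I (σ s) p ∘ σ = Function.update (I ∘ σ) s p := by
    rw [Function.update_comp_eq_of_injective _ σ.injective]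
  rw [this]; rfl

/-! ### The Levi-Civita connection of a metric in coordinates -/

/-- `g` is a smooth symmetric nondegenerate `2`-tensor on the open set `U` of coordinates.
Positivity plays no role in the tensor calculus. -/
structure IsMetricOn (g : Tensor n 2) (U : Set (EuclideanSpace ℝ (Fin n))) : Prop where
  isOpen : IsOpen U
  smooth : ∀ I, ContDiffOn ℝ ∞ (g I) U
  symm : ∀ y ∈ U, ∀ i j, g ![i, j] y = g ![j, i] y
  det_ne_zero : ∀ y ∈ U, (Matrix.of fun a b => g ![a, b] y).det ≠ 0

/-- The matrix `(g_{ij})` at the point with coordinates `y`. -/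
def metricMatrix (g : Tensor n 2) (y : EuclideanSpace ℝ (Fin n)) : Matrix (Fin n) (Fin n) ℝ :=
  Matrix.of fun a b => g ![a, b] y

/-- The connection matrix `Γ_i`, with entry `Γ^k_{il}` in row `k` and column `l`. -/
def connMatrix (g : Tensor n 2) (i : Fin n) (y : EuclideanSpace ℝ (Fin n)) :
    Matrix (Fin n) (Fin n) ℝ :=
  Matrix.of fun k l => christoffel g k i l y

/-- The curvature matrix `R_{ij}`, with entry `R^k_{ijl}` in row `k` and column `l`. -/
def curvMatrix (g : Tensor n 2) (i j : Fin n) (y : EuclideanSpace ℝ (Fin n)) :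
    Matrix (Fin n) (Fin n) ℝ :=
  Matrix.of fun k l => riemannUp g k i j l y

lemma inv_eq (g : Tensor n 2) (i j : Fin n) (y : EuclideanSpace ℝ (Fin n)) :
    inv g i j y = (metricMatrix g y)⁻¹ i j := rfl

namespace IsMetricOn
variable {g : Tensor n 2} {U : Set (EuclideanSpace ℝ (Fin n))} (hg : IsMetricOn g U)
  {y : EuclideanSpace ℝ (Fin n)}
include hg

lemma isUnit_det (hy : y ∈ U) : IsUnit (metricMatrix g y).det :=
  isUnit_iff_ne_zero.2 (hg.det_ne_zero y hy)

lemma metricMatrix_transpose (hy : y ∈ U) : (metricMatrix g y).transpose = metricMatrix g y := by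
  ext a b
  exact hg.symm y hy b a

lemma inv_symm (hy : y ∈ U) (i j : Fin n) : inv g i j y = inv g j i y := by
  have h := Matrix.transpose_nonsing_inv (metricMatrix g y)
  rw [hg.metricMatrix_transpose hy] at h
  exact congrFun (congrFun h j) i

lemma smooth_inv (i j : Fin n) : ContDiffOn ℝ ∞ (inv g i j) U :=
  contDiffOn_matrix_inv (m := metricMatrix g) (fun a b => hg.smooth ![a, b]) hg.det_ne_zero i j

lemma smooth_christoffel (k i j : Fin n) : ContDiffOn ℝ ∞ (christoffel g k i j) U :=
  contDiffOn_const.mul <| ContDiffOn.sum fun l _ => (hg.smooth_inv k l).mul <|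
    ((contDiffOn_partialDeriv hg.isOpen (hg.smooth _) i).add
      (contDiffOn_partialDeriv hg.isOpen (hg.smooth _) j)).sub
      (contDiffOn_partialDeriv hg.isOpen (hg.smooth _) l)

lemma smooth_riemannUp (k i j l : Fin n) : ContDiffOn ℝ ∞ (riemannUp g k i j l) U :=
  ((contDiffOn_partialDeriv hg.isOpen (hg.smooth_christoffel _ _ _) i).sub
    (contDiffOn_partialDeriv hg.isOpen (hg.smooth_christoffel _ _ _) j)).add <|
    ContDiffOn.sum fun _ _ => ((hg.smooth_christoffel _ _ _).mul (hg.smooth_christoffel _ _ _)).sub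
      ((hg.smooth_christoffel _ _ _).mul (hg.smooth_christoffel _ _ _))

lemma smooth_riemann (I : Fin 4 → Fin n) : ContDiffOn ℝ ∞ (riemann g I) U :=
  ContDiffOn.sum fun _ _ => (hg.smooth _).mul (hg.smooth_riemannUp _ _ _ _)

lemma smooth_ricci (I : Fin 2 → Fin n) : ContDiffOn ℝ ∞ (ricci g I) U :=
  ContDiffOn.sum fun _ _ => ContDiffOn.sum fun _ _ =>
    (hg.smooth_inv _ _).mul (hg.smooth_riemann _)

lemma partialDeriv_symm (hy : y ∈ U) (m i j : Fin n) :
    partialDeriv m (g ![i, j]) y = partialDeriv m (g ![j, i]) y :=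
  partialDeriv_congr_on hg.isOpen (fun z hz => hg.symm z hz i j) m hy

lemma christoffel_symm (hy : y ∈ U) (k i j : Fin n) :
    christoffel g k i j y = christoffel g k j i y := by
  unfold christoffel
  congr 1
  refine Finset.sum_congr rfl fun l _ => ?_
  rw [hg.partialDeriv_symm hy l i j]
  ring

/-- The Christoffel symbols of the first kind. -/
lemma metricMatrix_mul_connMatrix (hy : y ∈ U) (i k l : Fin n) :
    (metricMatrix g y * connMatrix g i y) k l = (1 / 2) * (partialDeriv i (g ![l, k]) y
      + partialDeriv l (g ![i, k]) y - partialDeriv k (g ![i, l]) y) := by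
  have h : connMatrix g i y = (metricMatrix g y)⁻¹ * Matrix.of fun m l => (1 / 2) *
      (partialDeriv i (g ![l, m]) y + partialDeriv l (g ![i, m]) y
        - partialDeriv m (g ![i, l]) y) := by
    ext p l
    simp only [connMatrix, christoffel, Matrix.mul_apply, Matrix.of_apply, inv_eq,
      Finset.mul_sum]
    exact Finset.sum_congr rfl fun _ _ => by ring
  rw [h, ← Matrix.mul_assoc, Matrix.mul_nonsing_inv _ (hg.isUnit_det hy), Matrix.one_mul]
  rfl

/-- The metric is parallel. -/
lemma matrixDeriv_metricMatrix (hy : y ∈ U) (m : Fin n) :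
    matrixDeriv m (metricMatrix g) y
      = (connMatrix g m y).transpose * metricMatrix g y + metricMatrix g y * connMatrix g m y := by
  have h : (connMatrix g m y).transpose * metricMatrix g y
      = (metricMatrix g y * connMatrix g m y).transpose := by
    rw [Matrix.transpose_mul, hg.metricMatrix_transpose hy]
  ext a b
  rw [h, Matrix.add_apply, Matrix.transpose_apply, hg.metricMatrix_mul_connMatrix hy,
    hg.metricMatrix_mul_connMatrix hy, hg.partialDeriv_symm hy m b a]
  simp only [matrixDeriv, metricMatrix, Matrix.of_apply]
  ring

lemma matrixDeriv_inv (hy : y ∈ U) (m : Fin n) :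
    matrixDeriv m (fun z => (metricMatrix g z)⁻¹) y
      = -(connMatrix g m y * (metricMatrix g y)⁻¹
        + (metricMatrix g y)⁻¹ * (connMatrix g m y).transpose) := by
  have h1 : matrixDeriv m (fun z => metricMatrix g z * (metricMatrix g z)⁻¹) y = 0 := by
    ext a b
    have := partialDeriv_congr_on hg.isOpen
      (f := fun z => (metricMatrix g z * (metricMatrix g z)⁻¹) a b)
      (f' := fun _ => (1 : Matrix (Fin n) (Fin n) ℝ) a b)
      (fun z hz => by rw [Matrix.mul_nonsing_inv _ (hg.isUnit_det hz)]) m hy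
    rw [partialDeriv_const] at this
    exact this
  rw [matrixDeriv_mul (m := metricMatrix g) (m' := fun z => (metricMatrix g z)⁻¹)
    (fun a b => differentiableAt_of_smoothOn hg.isOpen (hg.smooth ![a, b]) hy)
    (fun a b => differentiableAt_of_smoothOn hg.isOpen (hg.smooth_inv a b) hy),
    hg.matrixDeriv_metricMatrix hy] at h1
  have h2 := congrArg (fun X => (metricMatrix g y)⁻¹ * X) h1
  have hl := Matrix.nonsing_inv_mul _ (hg.isUnit_det hy)
  have hr := Matrix.mul_nonsing_inv _ (hg.isUnit_det hy)
  simp only [Matrix.mul_add, Matrix.add_mul, Matrix.mul_zero] at h2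
  simp only [Matrix.mul_assoc, hr, Matrix.mul_one] at h2
  simp only [← Matrix.mul_assoc, hl, Matrix.one_mul] at h2
  rw [eq_neg_iff_add_eq_zero, ← h2]
  abel

end IsMetricOn

lemma curvMatrix_eq (g : Tensor n 2) (i j : Fin n) (y : EuclideanSpace ℝ (Fin n)) :
    curvMatrix g i j y = matrixDeriv i (connMatrix g j) y - matrixDeriv j (connMatrix g i) y
      + (connMatrix g i y * connMatrix g j y - connMatrix g j y * connMatrix g i y) := by
  ext k l
  simp only [curvMatrix, riemannUp, matrixDeriv, connMatrix, Matrix.of_apply, Matrix.add_apply,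
    Matrix.sub_apply, Matrix.mul_apply, Finset.sum_sub_distrib]

lemma riemann_eq (g : Tensor n 2) (i j k l : Fin n) (y : EuclideanSpace ℝ (Fin n)) :
    riemann g ![i, j, k, l] y = (metricMatrix g y * curvMatrix g i j y) k l := rfl

/-! ### Covariant derivatives -/

lemma cov_cons (g : Tensor n 2) (S : Tensor n r) (m : Fin n) (I : Fin r → Fin n)
    (y : EuclideanSpace ℝ (Fin n)) :
    cov g S (Matrix.vecCons m I) y
      = partialDeriv m (S I) y - act (connMatrix g m y) (fun J => S J y) I := rfl

/-- The tensor with permuted slots, `I ↦ S (I ∘ σ)`. -/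
def permSlots (σ : Equiv.Perm (Fin r)) (S : Tensor n r) : Tensor n r := fun I => S (I ∘ σ)

/-- The permutation of `Fin (r + 1)` that fixes `0` and acts as `σ` on the successors. -/
def liftPerm (σ : Equiv.Perm (Fin r)) : Equiv.Perm (Fin (r + 1)) where
  toFun := Fin.cons 0 (Fin.succ ∘ σ)
  invFun := Fin.cons 0 (Fin.succ ∘ σ.symm)
  left_inv s := by cases s using Fin.cases <;> simp
  right_inv s := by cases s using Fin.cases <;> simp

lemma cov_permSlots (g : Tensor n 2) (S : Tensor n r) (σ : Equiv.Perm (Fin r)) :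
    cov g (permSlots σ S) = permSlots (liftPerm σ) (cov g S) := by
  funext I y
  have h0 : (I ∘ liftPerm σ) 0 = I 0 := rfl
  have h1 : Fin.tail (I ∘ liftPerm σ) = Fin.tail I ∘ σ := rfl
  have h := act_comp_perm (connMatrix g (I 0) y) (fun J => S J y) σ (Fin.tail I)
  unfold permSlots cov
  rw [h0, h1]
  exact congrArg (fun x => partialDeriv (I 0) (S (Fin.tail I ∘ σ)) y - x) h

lemma cov_congr_on {U : Set (EuclideanSpace ℝ (Fin n))} (hU : IsOpen U) (g : Tensor n 2)
    {S S' : Tensor n r} (h : ∀ y ∈ U, ∀ I, S I y = S' I y) :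
    ∀ y ∈ U, ∀ I, cov g S I y = cov g S' I y := by
  intro y hy I
  simp only [cov, h y hy]
  rw [partialDeriv_congr_on hU (fun z hz => h z hz (Fin.tail I)) (I 0) hy]

lemma smooth_cov {g : Tensor n 2} {U : Set (EuclideanSpace ℝ (Fin n))} (hg : IsMetricOn g U)
    {S : Tensor n r} (hS : ∀ I, ContDiffOn ℝ ∞ (S I) U) (I : Fin (r + 1) → Fin n) :
    ContDiffOn ℝ ∞ (cov g S I) U :=
  (contDiffOn_partialDeriv hg.isOpen (hS _) _).sub <| ContDiffOn.sum fun _ _ =>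
    ContDiffOn.sum fun _ _ => (hg.smooth_christoffel _ _ _).mul (hS _)

lemma cov_add (g : Tensor n 2) {S S' : Tensor n r} {y : EuclideanSpace ℝ (Fin n)}
    (hS : ∀ I, DifferentiableAt ℝ (S I) y) (hS' : ∀ I, DifferentiableAt ℝ (S' I) y)
    (I : Fin (r + 1) → Fin n) :
    cov g (fun J z => S J z + S' J z) I y = cov g S I y + cov g S' I y := by
  simp only [cov, mul_add, Finset.sum_add_distrib]
  rw [partialDeriv_add (hS _) (hS' _)]
  ring

lemma cov_const_mul (g : Tensor n 2) (c : ℝ) {S : Tensor n r} {y : EuclideanSpace ℝ (Fin n)}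
    (hS : ∀ I, DifferentiableAt ℝ (S I) y) (I : Fin (r + 1) → Fin n) :
    cov g (fun J z => c * S J z) I y = c * cov g S I y := by
  simp only [cov, mul_left_comm _ c, ← Finset.mul_sum]
  rw [partialDeriv_const_mul (hS _)]
  ring

lemma partialDeriv_act {M : EuclideanSpace ℝ (Fin n) → Matrix (Fin n) (Fin n) ℝ}
    {S : Tensor n r} {y : EuclideanSpace ℝ (Fin n)}
    (hM : ∀ a b, DifferentiableAt ℝ (fun z => M z a b) y)
    (hS : ∀ I, DifferentiableAt ℝ (S I) y) (m : Fin n) (I : Fin r → Fin n) :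
    partialDeriv m (fun z => act (M z) (fun J => S J z) I) y
      = act (matrixDeriv m M y) (fun J => S J y) I
        + act (M y) (fun J => partialDeriv m (S J) y) I := by
  simp only [act, ← Finset.sum_add_distrib]
  refine (partialDeriv_sum _ (fun s _ => DifferentiableAt.fun_sum fun p _ =>
    (hM _ _).mul (hS _)) m).trans (Finset.sum_congr rfl fun s _ => ?_)
  refine (partialDeriv_sum _ (fun p _ => (hM _ _).mul (hS _)) m).trans
    (Finset.sum_congr rfl fun p _ => ?_)
  exact partialDeriv_mul (hM _ _) (hS _) m

/-- The Ricci identity: the commutator of covariant derivatives of a covariant tensor is the action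
of the curvature on its slots. -/
lemma cov_cov_commutator {g : Tensor n 2} {U : Set (EuclideanSpace ℝ (Fin n))}
    (hg : IsMetricOn g U) {S : Tensor n r} (hS : ∀ I, ContDiffOn ℝ ∞ (S I) U)
    {y : EuclideanSpace ℝ (Fin n)} (hy : y ∈ U) (i j : Fin n) (I : Fin r → Fin n) :
    cov g (cov g S) (Matrix.vecCons i (Matrix.vecCons j I)) y
        - cov g (cov g S) (Matrix.vecCons j (Matrix.vecCons i I)) y
      = -act (curvMatrix g i j y) (fun J => S J y) I := by
  have hSd : ∀ I, DifferentiableAt ℝ (S I) y := fun I =>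
    differentiableAt_of_smoothOn hg.isOpen (hS I) hy
  have hΓ : ∀ m a b, DifferentiableAt ℝ (fun z => connMatrix g m z a b) y := fun m a b =>
    differentiableAt_of_smoothOn hg.isOpen (hg.smooth_christoffel a m b) hy
  have key : ∀ i j : Fin n, cov g (cov g S) (Matrix.vecCons i (Matrix.vecCons j I)) y
      = partialDeriv i (partialDeriv j (S I)) y
        - act (matrixDeriv i (connMatrix g j) y) (fun J => S J y) I
        - act (connMatrix g j y) (fun J => partialDeriv i (S J) y) I
        - ∑ p, christoffel g p i j y * cov g S (Matrix.vecCons p I) y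
        - act (connMatrix g i y) (fun J => partialDeriv j (S J) y) I
        + act (connMatrix g i y) (act (connMatrix g j y) (fun J => S J y)) I := by
    intro i j
    have h1 : partialDeriv i (cov g S (Matrix.vecCons j I)) y
        = partialDeriv i (partialDeriv j (S I)) y
          - (act (matrixDeriv i (connMatrix g j) y) (fun J => S J y) I
            + act (connMatrix g j y) (fun J => partialDeriv i (S J) y) I) := by
      rw [← partialDeriv_act (hΓ j) hSd]
      refine partialDeriv_sub
        (differentiableAt_of_smoothOn hg.isOpen (contDiffOn_partialDeriv hg.isOpen (hS I) j) hy)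
        ?_ i
      exact DifferentiableAt.fun_sum fun s _ => DifferentiableAt.fun_sum fun p _ =>
        (hΓ _ _ _).mul (hSd _)
    rw [cov_cons, h1, act_cons]
    simp only [cov_cons g S j, act_sub]
    simp only [connMatrix, Matrix.of_apply]
    ring
  have hcomm := act_commutator (connMatrix g i y) (connMatrix g j y) (fun J => S J y) I
  rw [key i j, key j i, partialDeriv_comm hg.isOpen (hS I) hy i j, curvMatrix_eq,
    act_matrix_add, act_matrix_sub]
  simp only [hg.christoffel_symm hy _ i j]
  rw [act_matrix_sub] at hcomm ⊢
  linarith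

/-- The contraction `g^{pq} S_{pq…}` of the first two slots. -/
def contract (g : Tensor n 2) (S : Tensor n (r + 2)) : Tensor n r := fun I y =>
  ∑ p, ∑ q, inv g p q y * S (Matrix.vecCons p (Matrix.vecCons q I)) y

/-- Covariant derivatives commute with contractions, because the inverse metric is parallel. -/
lemma cov_contract {g : Tensor n 2} {U : Set (EuclideanSpace ℝ (Fin n))}
    (hg : IsMetricOn g U) {S : Tensor n (r + 2)} (hS : ∀ I, ContDiffOn ℝ ∞ (S I) U)
    {y : EuclideanSpace ℝ (Fin n)} (hy : y ∈ U) (m : Fin n) (I : Fin r → Fin n) :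
    cov g (contract g S) (Matrix.vecCons m I) y
      = ∑ p, ∑ q, inv g p q y *
          cov g S (Matrix.vecCons m (Matrix.vecCons p (Matrix.vecCons q I))) y := by
  have hSd : ∀ I, DifferentiableAt ℝ (S I) y := fun I =>
    differentiableAt_of_smoothOn hg.isOpen (hS I) hy
  have hid : ∀ p q, DifferentiableAt ℝ (inv g p q) y := fun p q =>
    differentiableAt_of_smoothOn hg.isOpen (hg.smooth_inv p q) hy
  have h1 : partialDeriv m (contract g S I) y = ∑ p, ∑ q,
      (partialDeriv m (inv g p q) y * S (Matrix.vecCons p (Matrix.vecCons q I)) y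
        + inv g p q y * partialDeriv m (S (Matrix.vecCons p (Matrix.vecCons q I))) y) := by
    refine (partialDeriv_sum _ (fun p _ => DifferentiableAt.fun_sum fun q _ =>
      (hid p q).mul (hSd _)) m).trans (Finset.sum_congr rfl fun p _ => ?_)
    refine (partialDeriv_sum _ (fun q _ => (hid p q).mul (hSd _)) m).trans
      (Finset.sum_congr rfl fun q _ => ?_)
    exact partialDeriv_mul (hid p q) (hSd _) m
  have hinv : ∀ p q, partialDeriv m (inv g p q) y
      = -((∑ a, christoffel g p m a y * inv g a q y)
        + ∑ a, inv g p a y * christoffel g q m a y) := fun p q =>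
    congrFun (congrFun (hg.matrixDeriv_inv hy m) p) q
  rw [cov_cons, h1]
  simp only [contract, act_sum, act_const_mul, cov_cons, act_cons, hinv, mul_sub, mul_add,
    add_mul, neg_mul, Finset.sum_add_distrib, Finset.sum_sub_distrib, Finset.sum_neg_distrib,
    neg_add]
  have e1 : ∑ p, ∑ q, (∑ a, christoffel g p m a y * inv g a q y)
        * S (Matrix.vecCons p (Matrix.vecCons q I)) y
      = ∑ p, ∑ q, inv g p q y * ∑ a, connMatrix g m y a p
        * S (Matrix.vecCons a (Matrix.vecCons q I)) y := by
    simp only [Finset.sum_mul, Finset.mul_sum]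
    rw [Finset.sum_comm, Finset.sum_congr rfl fun q _ => Finset.sum_comm, Finset.sum_comm]
    refine Finset.sum_congr rfl fun p _ => Finset.sum_congr rfl fun q _ =>
      Finset.sum_congr rfl fun a _ => ?_
    simp only [connMatrix, Matrix.of_apply]
    ring
  have e2 : ∑ p, ∑ q, (∑ a, inv g p a y * christoffel g q m a y)
        * S (Matrix.vecCons p (Matrix.vecCons q I)) y
      = ∑ p, ∑ q, inv g p q y * ∑ a, connMatrix g m y a q
        * S (Matrix.vecCons p (Matrix.vecCons a I)) y := by
    simp only [Finset.sum_mul, Finset.mul_sum]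
    refine Finset.sum_congr rfl fun p _ => ?_
    rw [Finset.sum_comm]
    refine Finset.sum_congr rfl fun q _ => Finset.sum_congr rfl fun a _ => ?_
    simp only [connMatrix, Matrix.of_apply]
    ring
  rw [e1, e2]
  ring

/-! ### Symmetries of the curvature tensor -/

lemma curvMatrix_swap (g : Tensor n 2) (i j : Fin n) (y : EuclideanSpace ℝ (Fin n)) :
    curvMatrix g j i y = -curvMatrix g i j y := by
  rw [curvMatrix_eq, curvMatrix_eq]
  abel

lemma riemann_swap_fst (g : Tensor n 2) (i j k l : Fin n) (y : EuclideanSpace ℝ (Fin n)) :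
    riemann g ![j, i, k, l] y = -riemann g ![i, j, k, l] y := by
  rw [riemann_eq, riemann_eq, curvMatrix_swap, Matrix.mul_neg, Matrix.neg_apply]

namespace IsMetricOn
variable {g : Tensor n 2} {U : Set (EuclideanSpace ℝ (Fin n))} (hg : IsMetricOn g U)
  {y : EuclideanSpace ℝ (Fin n)}
include hg

lemma riemannUp_bianchi (hy : y ∈ U) (k i j l : Fin n) :
    riemannUp g k i j l y + riemannUp g k j l i y + riemannUp g k l i j y = 0 := by
  have hd : ∀ m a b, partialDeriv m (christoffel g k a b) y
      = partialDeriv m (christoffel g k b a) y := fun m a b =>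
    partialDeriv_congr_on hg.isOpen (fun z hz => hg.christoffel_symm hz k a b) m hy
  simp only [riemannUp, Finset.sum_sub_distrib]
  rw [hd i j l, hd j i l, hd l j i]
  simp only [hg.christoffel_symm hy _ j i, hg.christoffel_symm hy _ l i,
    hg.christoffel_symm hy _ l j]
  ring

/-- The first Bianchi identity; the cyclic slots are the first, the second and the fourth. -/
lemma riemann_bianchi (hy : y ∈ U) (i j k l : Fin n) :
    riemann g ![i, j, k, l] y + riemann g ![j, l, k, i] y + riemann g ![l, i, k, j] y = 0 := by
  simp only [riemann_eq, Matrix.mul_apply, ← Finset.sum_add_distrib, ← mul_add]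
  refine Finset.sum_eq_zero fun p _ => ?_
  simp only [curvMatrix, Matrix.of_apply, hg.riemannUp_bianchi hy, mul_zero]

lemma cov_metric (hy : y ∈ U) (I : Fin 3 → Fin n) : cov g g I y = 0 := by
  have hI : I = ![I 0, I 1, I 2] := by funext s; fin_cases s <;> rfl
  have h := congrFun (congrFun (hg.matrixDeriv_metricMatrix hy (I 0)) (I 1)) (I 2)
  have h' : partialDeriv (I 0) (g ![I 1, I 2]) y
      = ∑ p, connMatrix g (I 0) y p (I 1) * g ![p, I 2] y
        + ∑ p, g ![I 1, p] y * connMatrix g (I 0) y p (I 2) := h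
  rw [hI, cov_cons, act_cons, act_cons, act_empty, h']
  simp only [mul_comm (g _ y)]
  ring

lemma riemann_swap_snd (hy : y ∈ U) (i j k l : Fin n) :
    riemann g ![i, j, l, k] y = -riemann g ![i, j, k, l] y := by
  -- The Ricci identity for the parallel tensor `g`.
  have h := cov_cov_commutator hg hg.smooth hy i j ![k, l]
  have h0 : ∀ I, cov g (cov g g) I y = 0 := fun I => by
    rw [cov_congr_on hg.isOpen g (S' := fun _ _ => 0) (fun z hz J => hg.cov_metric hz J) y hy I]
    simp [cov, partialDeriv_const]
  rw [h0, h0, act_cons, act_cons, act_empty] at h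
  simp only [riemann_eq, Matrix.mul_apply, metricMatrix, Matrix.of_apply]
  simp only [mul_comm (curvMatrix g i j y _ _), hg.symm y hy _ l] at h
  linarith

lemma riemann_pair_symm (hy : y ∈ U) (i j k l : Fin n) :
    riemann g ![k, l, i, j] y = riemann g ![i, j, k, l] y := by
  have b := hg.riemann_bianchi hy
  have s1 := fun a b c d => riemann_swap_fst g a b c d y
  have s2 := hg.riemann_swap_snd hy
  linarith [b i j k l, b j k l i, b k l i j, b l i j k, s1 i j k l, s1 i j l k, s1 k l i j,
    s1 k l j i, s1 i k j l, s1 i k l j, s1 j l i k, s1 j l k i, s1 i l j k, s1 i l k j,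
    s1 j k i l, s1 j k l i, s2 i j k l, s2 j i k l, s2 k l i j, s2 l k i j, s2 i k j l,
    s2 k i j l, s2 j l i k, s2 l j i k, s2 i l j k, s2 l i j k, s2 j k i l, s2 k j i l]

lemma ricci_symm (hy : y ∈ U) (i k : Fin n) : ricci g ![k, i] y = ricci g ![i, k] y := by
  change ∑ a, ∑ b, inv g a b y * riemann g ![k, a, i, b] y
    = ∑ a, ∑ b, inv g a b y * riemann g ![i, a, k, b] y
  rw [Finset.sum_comm]
  refine Finset.sum_congr rfl fun a _ => Finset.sum_congr rfl fun b _ => ?_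
  rw [hg.inv_symm hy, hg.riemann_pair_symm hy]

/-- The covariant derivative of the curvature in terms of matrices; the last two sums come from
the first two slots. -/
lemma cov_riemann (hy : y ∈ U) (m i j k l : Fin n) :
    cov g (riemann g) ![m, i, j, k, l] y
      = (metricMatrix g y * (matrixDeriv m (curvMatrix g i j) y
          + (connMatrix g m y * curvMatrix g i j y - curvMatrix g i j y * connMatrix g m y))) k l
        - ∑ p, christoffel g p m i y * riemann g ![p, j, k, l] y
        - ∑ p, christoffel g p m j y * riemann g ![i, p, k, l] y := by
  have h1 : partialDeriv m (riemann g ![i, j, k, l]) y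
      = (matrixDeriv m (fun z => metricMatrix g z * curvMatrix g i j z) y) k l := rfl
  rw [matrixDeriv_mul (m := metricMatrix g) (m' := curvMatrix g i j)
    (fun a b => differentiableAt_of_smoothOn hg.isOpen (hg.smooth ![a, b]) hy)
    (fun a b => differentiableAt_of_smoothOn hg.isOpen (hg.smooth_riemannUp a i j b) hy),
    hg.matrixDeriv_metricMatrix hy] at h1
  have h3 : ∑ p, connMatrix g m y p k * riemann g ![i, j, p, l] y
      = ((connMatrix g m y).transpose * (metricMatrix g y * curvMatrix g i j y)) k l := by
    rw [Matrix.mul_apply]; rfl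
  have h4 : ∑ p, connMatrix g m y p l * riemann g ![i, j, k, p] y
      = ((metricMatrix g y * curvMatrix g i j y) * connMatrix g m y) k l := by
    rw [Matrix.mul_apply]
    exact Finset.sum_congr rfl fun p _ => mul_comm _ _
  rw [cov_cons, act_cons, act_cons, act_cons, act_cons, act_empty, h1, h3, h4]
  simp only [connMatrix, Matrix.of_apply, Matrix.mul_add, Matrix.mul_sub, Matrix.add_mul,
    Matrix.mul_assoc, Matrix.add_apply, Matrix.sub_apply]
  ring

lemma matrixDeriv_comm {m : EuclideanSpace ℝ (Fin n) → Matrix (Fin n) (Fin n) ℝ}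
    (hm : ∀ a b, ContDiffOn ℝ ∞ (fun z => m z a b) U) (hy : y ∈ U) (i j : Fin n) :
    matrixDeriv i (matrixDeriv j m) y = matrixDeriv j (matrixDeriv i m) y := by
  ext a b
  exact partialDeriv_comm hg.isOpen (hm a b) hy i j

lemma matrixDeriv_curvMatrix (hy : y ∈ U) (m i j : Fin n) :
    matrixDeriv m (curvMatrix g i j) y
      = matrixDeriv m (matrixDeriv i (connMatrix g j)) y
        - matrixDeriv m (matrixDeriv j (connMatrix g i)) y
        + (matrixDeriv m (connMatrix g i) y * connMatrix g j y
          + connMatrix g i y * matrixDeriv m (connMatrix g j) y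
          - (matrixDeriv m (connMatrix g j) y * connMatrix g i y
            + connMatrix g j y * matrixDeriv m (connMatrix g i) y)) := by
  have hΓ : ∀ i a b, ContDiffOn ℝ ∞ (fun z => connMatrix g i z a b) U := fun i a b =>
    hg.smooth_christoffel a i b
  have hd : ∀ i a b, DifferentiableAt ℝ (fun z => connMatrix g i z a b) y := fun i a b =>
    differentiableAt_of_smoothOn hg.isOpen (hΓ i a b) hy
  have hdd : ∀ i j a b, DifferentiableAt ℝ (fun z => matrixDeriv i (connMatrix g j) z a b) y :=
    fun i j a b => differentiableAt_of_smoothOn hg.isOpen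
      (contDiffOn_partialDeriv hg.isOpen (hΓ j a b) i) hy
  have hmul : ∀ i j a b, DifferentiableAt ℝ
      (fun z => (connMatrix g i z * connMatrix g j z) a b) y := fun i j a b => by
    simp only [Matrix.mul_apply]
    exact DifferentiableAt.fun_sum fun c _ => (hd i a c).mul (hd j c b)
  rw [funext (curvMatrix_eq g i j),
    matrixDeriv_add (m := fun z => matrixDeriv i (connMatrix g j) z
      - matrixDeriv j (connMatrix g i) z)
      (m' := fun z => connMatrix g i z * connMatrix g j z - connMatrix g j z * connMatrix g i z)
      (fun a b => (hdd i j a b).sub (hdd j i a b)) (fun a b => (hmul i j a b).sub (hmul j i a b)),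
    matrixDeriv_sub (hdd i j) (hdd j i), matrixDeriv_sub (hmul i j) (hmul j i),
    matrixDeriv_mul (hd i) (hd j), matrixDeriv_mul (hd j) (hd i)]

/-- The second Bianchi identity: in terms of matrices, it is the Jacobi identity for
`∂_i + Γ_i`. -/
lemma cov_riemann_bianchi (hy : y ∈ U) (m i j k l : Fin n) :
    cov g (riemann g) ![m, i, j, k, l] y + cov g (riemann g) ![i, j, m, k, l] y
      + cov g (riemann g) ![j, m, i, k, l] y = 0 := by
  have hΓ : ∀ i a b, ContDiffOn ℝ ∞ (fun z => connMatrix g i z a b) U := fun i a b =>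
    hg.smooth_christoffel a i b
  have hJ : (matrixDeriv m (curvMatrix g i j) y
          + (connMatrix g m y * curvMatrix g i j y - curvMatrix g i j y * connMatrix g m y))
        + (matrixDeriv i (curvMatrix g j m) y
          + (connMatrix g i y * curvMatrix g j m y - curvMatrix g j m y * connMatrix g i y))
        + (matrixDeriv j (curvMatrix g m i) y
          + (connMatrix g j y * curvMatrix g m i y - curvMatrix g m i y * connMatrix g j y))
        = 0 := by
    simp only [hg.matrixDeriv_curvMatrix hy, curvMatrix_eq]
    rw [hg.matrixDeriv_comm (hΓ j) hy m i, hg.matrixDeriv_comm (hΓ i) hy m j,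
      hg.matrixDeriv_comm (hΓ m) hy i j]
    noncomm_ring
  have hJ' := Matrix.ext_iff.2 (congrArg (fun X => metricMatrix g y * X) hJ) k l
  rw [Matrix.mul_add, Matrix.mul_add, Matrix.mul_zero, Matrix.add_apply, Matrix.add_apply,
    Matrix.zero_apply] at hJ'
  rw [hg.cov_riemann hy, hg.cov_riemann hy, hg.cov_riemann hy]
  have hs : ∀ a b c, ∑ p, christoffel g p b a y * riemann g ![c, p, k, l] y
      = -∑ p, christoffel g p a b y * riemann g ![p, c, k, l] y := fun a b c => by
    rw [← Finset.sum_neg_distrib]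
    refine Finset.sum_congr rfl fun p _ => ?_
    rw [hg.christoffel_symm hy p b a, riemann_swap_fst g p c]
    ring
  rw [hs j m i, hs m i j, hs i j m]
  linarith

end IsMetricOn

/-! ### Second covariant derivatives of the curvature -/

namespace IsMetricOn
variable {g : Tensor n 2} {U : Set (EuclideanSpace ℝ (Fin n))} (hg : IsMetricOn g U)
  {y : EuclideanSpace ℝ (Fin n)}
include hg

/-- A symmetry or antisymmetry of a tensor passes to its covariant derivative. -/
lemma cov_of_perm_eq {S : Tensor n r} (hS : ∀ I, ContDiffOn ℝ ∞ (S I) U)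
    {σ : Equiv.Perm (Fin r)} {c : ℝ} (h : ∀ z ∈ U, ∀ I, S (I ∘ σ) z = c * S I z) (hy : y ∈ U)
    (I : Fin (r + 1) → Fin n) : cov g S (I ∘ liftPerm σ) y = c * cov g S I y := by
  rw [← cov_const_mul g c fun J => differentiableAt_of_smoothOn hg.isOpen (hS J) hy,
    ← cov_congr_on hg.isOpen g (S := permSlots σ S) h y hy I, cov_permSlots]
  rfl

/-- A cyclic identity of a tensor passes to its covariant derivative. -/
lemma cov_of_perm_sum_eq_zero {S : Tensor n r} (hS : ∀ I, ContDiffOn ℝ ∞ (S I) U)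
    {σ τ : Equiv.Perm (Fin r)} (h : ∀ z ∈ U, ∀ I, S I z + S (I ∘ σ) z + S (I ∘ τ) z = 0)
    (hy : y ∈ U) (I : Fin (r + 1) → Fin n) :
    cov g S I y + cov g S (I ∘ liftPerm σ) y + cov g S (I ∘ liftPerm τ) y = 0 := by
  have hd : ∀ J, DifferentiableAt ℝ (S J) y := fun J =>
    differentiableAt_of_smoothOn hg.isOpen (hS J) hy
  have h1 := cov_congr_on hg.isOpen g
    (S := fun J z => (S J z + permSlots σ S J z) + permSlots τ S J z) (S' := fun _ _ => 0) h y hy I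
  rw [cov_add g (S := fun J z => S J z + permSlots σ S J z) (S' := permSlots τ S)
      (fun J => (hd J).add (hd (J ∘ σ))) (fun J => hd (J ∘ τ)),
    cov_add g (S' := permSlots σ S) hd (fun J => hd (J ∘ σ)), cov_permSlots, cov_permSlots] at h1
  have h0 : cov g (fun (_ : Fin r → Fin n) _ => (0 : ℝ)) I y = 0 := by
    simp [cov, partialDeriv_const]
  rw [h0] at h1
  exact h1

lemma smooth_cov_riemann (I : Fin 5 → Fin n) : ContDiffOn ℝ ∞ (cov g (riemann g) I) U :=
  smooth_cov hg hg.smooth_riemann I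

lemma cov_cov_riemann_swap_fst (hy : y ∈ U) (a b i j k l : Fin n) :
    cov g (cov g (riemann g)) ![a, b, j, i, k, l] y
      = -cov g (cov g (riemann g)) ![a, b, i, j, k, l] y := by
  have h0 : ∀ z ∈ U, ∀ I, riemann g (I ∘ Equiv.swap (0 : Fin 4) 1) z = (-1) * riemann g I z := by
    intro z _ I
    have e1 : I = ![I 0, I 1, I 2, I 3] := by funext s; fin_cases s <;> rfl
    have e2 : I ∘ Equiv.swap (0 : Fin 4) 1 = ![I 1, I 0, I 2, I 3] := by
      funext s; fin_cases s <;> rfl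
    rw [e2, riemann_swap_fst, ← e1, neg_one_mul]
  have h2 := hg.cov_of_perm_eq hg.smooth_cov_riemann
    (fun z hz I => hg.cov_of_perm_eq hg.smooth_riemann h0 hz I) hy ![a, b, i, j, k, l]
  rw [neg_one_mul] at h2
  rw [← h2]
  congr 1
  funext s; fin_cases s <;> rfl

lemma cov_cov_riemann_pair_symm (hy : y ∈ U) (a b i j k l : Fin n) :
    cov g (cov g (riemann g)) ![a, b, k, l, i, j] y
      = cov g (cov g (riemann g)) ![a, b, i, j, k, l] y := by
  have h0 : ∀ z ∈ U, ∀ I, riemann g (I ∘ (Equiv.swap (0 : Fin 4) 2 * Equiv.swap 1 3 :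
      Equiv.Perm (Fin 4))) z = 1 * riemann g I z := by
    intro z hz I
    have e1 : I = ![I 0, I 1, I 2, I 3] := by funext s; fin_cases s <;> rfl
    have e2 : I ∘ (Equiv.swap (0 : Fin 4) 2 * Equiv.swap 1 3 : Equiv.Perm (Fin 4))
        = ![I 2, I 3, I 0, I 1] := by
      funext s; fin_cases s <;> rfl
    rw [e2, hg.riemann_pair_symm hz, ← e1, one_mul]
  have h2 := hg.cov_of_perm_eq hg.smooth_cov_riemann
    (fun z hz I => hg.cov_of_perm_eq hg.smooth_riemann h0 hz I) hy ![a, b, i, j, k, l]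
  rw [one_mul] at h2
  rw [← h2]
  congr 1
  funext s; fin_cases s <;> rfl

lemma cov_cov_riemann_bianchi (hy : y ∈ U) (a m i j k l : Fin n) :
    cov g (cov g (riemann g)) ![a, m, i, j, k, l] y
      + cov g (cov g (riemann g)) ![a, i, j, m, k, l] y
      + cov g (cov g (riemann g)) ![a, j, m, i, k, l] y = 0 := by
  have h0 : ∀ z ∈ U, ∀ I, cov g (riemann g) I z
      + cov g (riemann g) (I ∘ (Equiv.swap (0 : Fin 5) 1 * Equiv.swap 1 2 :
        Equiv.Perm (Fin 5))) z
      + cov g (riemann g) (I ∘ (Equiv.swap (1 : Fin 5) 2 * Equiv.swap 0 1 :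
        Equiv.Perm (Fin 5))) z = 0 := by
    intro z hz I
    have e1 : I = ![I 0, I 1, I 2, I 3, I 4] := by funext s; fin_cases s <;> rfl
    have e2 : I ∘ (Equiv.swap (0 : Fin 5) 1 * Equiv.swap 1 2 : Equiv.Perm (Fin 5))
        = ![I 1, I 2, I 0, I 3, I 4] := by
      funext s; fin_cases s <;> rfl
    have e3 : I ∘ (Equiv.swap (1 : Fin 5) 2 * Equiv.swap 0 1 : Equiv.Perm (Fin 5))
        = ![I 2, I 0, I 1, I 3, I 4] := by
      funext s; fin_cases s <;> rfl
    have := hg.cov_riemann_bianchi hz (I 0) (I 1) (I 2) (I 3) (I 4)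
    rwa [← e1, ← e2, ← e3] at this
  have h2 := hg.cov_of_perm_sum_eq_zero hg.smooth_cov_riemann h0 hy ![a, m, i, j, k, l]
  have e2 : ![a, m, i, j, k, l] ∘ liftPerm (Equiv.swap (0 : Fin 5) 1 * Equiv.swap 1 2)
      = ![a, i, j, m, k, l] := by
    funext s; fin_cases s <;> rfl
  have e3 : ![a, m, i, j, k, l] ∘ liftPerm (Equiv.swap (1 : Fin 5) 2 * Equiv.swap 0 1)
      = ![a, j, m, i, k, l] := by
    funext s; fin_cases s <;> rfl
  rwa [e2, e3] at h2

/-- `∇_a ∇_b` commutes with the contraction `g^{pq}`. -/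
lemma cov_cov_contract {S : Tensor n 4} (hS : ∀ I, ContDiffOn ℝ ∞ (S I) U) (hy : y ∈ U)
    (a b i j : Fin n) :
    cov g (cov g (contract g S)) ![a, b, i, j] y
      = ∑ p, ∑ q, inv g p q y * cov g (cov g S) ![a, b, p, q, i, j] y := by
  -- The contracted slots of `cov g S` are the second and the third; they are brought to the front.
  set σ : Equiv.Perm (Fin 5) := Equiv.swap (0 : Fin 5) 1 * Equiv.swap 0 2 with hσ
  have hperm : ∀ b p q i j : Fin n, ![p, q, b, i, j] ∘ σ = ![b, p, q, i, j] := by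
    intro b p q i j
    funext s; fin_cases s <;> rfl
  have h1 : ∀ z ∈ U, ∀ I, cov g (contract g S) I z
      = contract g (permSlots σ (cov g S)) I z := by
    intro z hz I
    have e1 : I = ![I 0, I 1, I 2] := by funext s; fin_cases s <;> rfl
    rw [e1, cov_contract hg hS hz]
    refine Finset.sum_congr rfl fun p _ => Finset.sum_congr rfl fun q _ => ?_
    rw [permSlots, hperm]
  rw [cov_congr_on hg.isOpen g h1 y hy,
    cov_contract hg (S := permSlots σ (cov g S)) (fun I => smooth_cov hg hS (I ∘ σ)) hy,
    cov_permSlots]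
  refine Finset.sum_congr rfl fun p _ => Finset.sum_congr rfl fun q _ => ?_
  rw [permSlots]
  congr 2
  funext s; fin_cases s <;> rfl

lemma cov_cov_ricci (hy : y ∈ U) (a b i j : Fin n) :
    cov g (cov g (ricci g)) ![a, b, i, j] y
      = ∑ p, ∑ q, inv g p q y * cov g (cov g (riemann g)) ![a, b, p, i, q, j] y := by
  have h1 : ∀ z ∈ U, ∀ I, ricci g I z
      = contract g (permSlots (Equiv.swap (1 : Fin 4) 2) (riemann g)) I z := by
    intro z hz I
    have e1 : I = ![I 0, I 1] := by funext s; fin_cases s <;> rfl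
    refine Finset.sum_congr rfl fun p _ => Finset.sum_congr rfl fun q _ => ?_
    have e2 : Matrix.vecCons p (Matrix.vecCons q I) ∘ Equiv.swap (1 : Fin 4) 2
        = ![p, I 0, q, I 1] := by
      funext s; fin_cases s <;> rfl
    rw [permSlots, e2, riemann_swap_fst, hg.riemann_swap_snd hz, neg_neg]
  have h2 : ∀ z ∈ U, ∀ I, cov g (ricci g) I z
      = cov g (contract g (permSlots (Equiv.swap (1 : Fin 4) 2) (riemann g))) I z :=
    cov_congr_on hg.isOpen g h1
  rw [cov_congr_on hg.isOpen g h2 y hy,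
    hg.cov_cov_contract (S := permSlots (Equiv.swap (1 : Fin 4) 2) (riemann g))
      (fun I => hg.smooth_riemann (I ∘ Equiv.swap (1 : Fin 4) 2)) hy,
    cov_permSlots, cov_permSlots]
  refine Finset.sum_congr rfl fun p _ => Finset.sum_congr rfl fun q _ => ?_
  rw [permSlots]
  congr 2
  funext s; fin_cases s <;> rfl

/-! ### The Laplacian of the curvature -/

lemma riemannUp_eq (hy : y ∈ U) (k i j l : Fin n) :
    riemannUp g k i j l y = ∑ b, inv g k b y * riemann g ![i, j, b, l] y := by
  have h : curvMatrix g i j y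
      = (metricMatrix g y)⁻¹ * (metricMatrix g y * curvMatrix g i j y) := by
    rw [← Matrix.mul_assoc, Matrix.nonsing_inv_mul _ (hg.isUnit_det hy), Matrix.one_mul]
  exact Matrix.ext_iff.2 h k l

/-- The contraction pattern of `quadB`, with an arbitrary second factor `W`. -/
lemma sum_riemannUp_mul (hy : y ∈ U) (i j : Fin n) (W : Fin n → Fin n → ℝ) :
    ∑ p, ∑ q, inv g p q y * ∑ a, riemannUp g a p i j y * W q a
      = ∑ p, ∑ q, ∑ r, ∑ s, inv g p r y * inv g q s y * riemann g ![p, i, q, j] y * W r s := by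
  refine Finset.sum_congr rfl fun p _ => ?_
  rw [Finset.sum_comm (s := Finset.univ) (t := Finset.univ)
    (f := fun q r => ∑ s, inv g p r y * inv g q s y * riemann g ![p, i, q, j] y * W r s)]
  refine Finset.sum_congr rfl fun r _ => ?_
  simp only [hg.riemannUp_eq hy, Finset.sum_mul, Finset.mul_sum]
  rw [Finset.sum_comm]
  refine Finset.sum_congr rfl fun q _ => Finset.sum_congr rfl fun s _ => ?_
  rw [hg.inv_symm hy s q]
  ring

lemma quadB_symm (hy : y ∈ U) (i j k l : Fin n) :
    quadB g ![j, i, l, k] y = quadB g ![i, j, k, l] y := by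
  change ∑ p, ∑ q, ∑ r, ∑ s, inv g p r y * inv g q s y *
      riemann g ![p, j, q, i] y * riemann g ![r, l, s, k] y
    = ∑ p, ∑ q, ∑ r, ∑ s, inv g p r y * inv g q s y *
      riemann g ![p, i, q, j] y * riemann g ![r, k, s, l] y
  rw [Finset.sum_comm]
  refine Finset.sum_congr rfl fun p _ => Finset.sum_congr rfl fun q _ => ?_
  rw [Finset.sum_comm]
  refine Finset.sum_congr rfl fun r _ => Finset.sum_congr rfl fun s _ => ?_
  rw [hg.riemann_pair_symm hy p i q j, hg.riemann_pair_symm hy r k s l]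
  ring

lemma quadB_pair_symm (hy : y ∈ U) (i j k l : Fin n) :
    quadB g ![k, l, i, j] y = quadB g ![i, j, k, l] y := by
  change ∑ p, ∑ q, ∑ r, ∑ s, inv g p r y * inv g q s y *
      riemann g ![p, k, q, l] y * riemann g ![r, i, s, j] y
    = ∑ p, ∑ q, ∑ r, ∑ s, inv g p r y * inv g q s y *
      riemann g ![p, i, q, j] y * riemann g ![r, k, s, l] y
  simp only [← Fintype.sum_prod_type']
  refine Fintype.sum_equiv ⟨fun x => (x.2.2.1, x.2.2.2, x.1, x.2.1),
    fun x => (x.2.2.1, x.2.2.2, x.1, x.2.1), fun _ => rfl, fun _ => rfl⟩ _ _ ?_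
  rintro ⟨p, q, r, s⟩
  simp only [Equiv.coe_fn_mk]
  rw [hg.inv_symm hy r p, hg.inv_symm hy s q]
  ring

/-- The quadratic curvature terms arising when the two derivatives in
`g^{pq} ∇_p ∇_i R_{qjkl}` are interchanged. -/
lemma sum_act_curvMatrix (hy : y ∈ U) (i j k l : Fin n) :
    ∑ p, ∑ q, inv g p q y *
        act (curvMatrix g p i y) (fun J => riemann g J y) ![q, j, k, l]
      = -(∑ p, ∑ q, inv g p q y * (riemann g ![p, j, k, l] y * ricci g ![q, i] y))
        + quadB g ![i, j, k, l] y - quadB g ![i, j, l, k] y + quadB g ![i, k, j, l] y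
        - quadB g ![i, l, j, k] y := by
  have hact : ∀ p q, act (curvMatrix g p i y) (fun J => riemann g J y) ![q, j, k, l]
      = ∑ a, riemannUp g a p i q y * riemann g ![a, j, k, l] y
        + ∑ a, riemannUp g a p i j y * riemann g ![q, a, k, l] y
        + ∑ a, riemannUp g a p i k y * riemann g ![q, j, a, l] y
        + ∑ a, riemannUp g a p i l y * riemann g ![q, j, k, a] y := by
    intro p q
    rw [act_cons, act_cons, act_cons, act_cons, act_empty]
    simp only [curvMatrix, Matrix.of_apply]
    ring
  have hB : ∀ i j k l, quadB g ![i, j, k, l] y = ∑ p, ∑ q, ∑ r, ∑ s,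
      inv g p r y * inv g q s y * riemann g ![p, i, q, j] y * riemann g ![r, k, s, l] y :=
    fun _ _ _ _ => rfl
  have hQ1 : ∑ p, ∑ q, inv g p q y * ∑ a, riemannUp g a p i q y * riemann g ![a, j, k, l] y
      = -(∑ p, ∑ q, inv g p q y * (riemann g ![p, j, k, l] y * ricci g ![q, i] y)) := by
    have hric : ∀ q, ricci g ![q, i] y = -∑ a, ∑ b, inv g a b y * riemann g ![a, i, q, b] y := by
      intro q
      rw [← Finset.sum_neg_distrib]
      change ∑ a, ∑ b, inv g a b y * riemann g ![q, a, i, b] y = _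
      rw [Finset.sum_comm]
      refine Finset.sum_congr rfl fun a _ => ?_
      rw [← Finset.sum_neg_distrib]
      refine Finset.sum_congr rfl fun b _ => ?_
      rw [hg.inv_symm hy b a, hg.riemann_pair_symm hy i a q b, riemann_swap_fst g a i]
      ring
    simp only [hric, hg.riemannUp_eq hy, Finset.sum_mul, Finset.mul_sum, mul_neg,
      Finset.sum_neg_distrib, neg_neg]
    -- The sums run over `p q a b` on the left and over `a b p q` on the right.
    calc _ = ∑ p, ∑ a, ∑ q, ∑ b, inv g p q y * (inv g a b y * riemann g ![p, i, b, q] y *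
              riemann g ![a, j, k, l] y) :=
            Finset.sum_congr rfl fun _ _ => Finset.sum_comm
      _ = ∑ a, ∑ p, ∑ b, ∑ q, inv g p q y * (inv g a b y * riemann g ![p, i, b, q] y *
              riemann g ![a, j, k, l] y) := by
            rw [Finset.sum_comm]
            exact Finset.sum_congr rfl fun _ _ => Finset.sum_congr rfl fun _ _ => Finset.sum_comm
      _ = _ := by
            refine Finset.sum_congr rfl fun a _ => ?_
            rw [Finset.sum_comm]
            refine Finset.sum_congr rfl fun b _ => Finset.sum_congr rfl fun p _ =>
              Finset.sum_congr rfl fun q _ => ?_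
            ring
  have hQ2 : ∑ p, ∑ q, inv g p q y * ∑ a, riemannUp g a p i j y * riemann g ![q, a, k, l] y
      = quadB g ![i, j, k, l] y - quadB g ![i, j, l, k] y := by
    -- The first Bianchi identity, with the slots in the order in which `quadB` contracts them.
    have hW : ∀ q a, riemann g ![q, a, k, l] y
        = riemann g ![q, k, a, l] y - riemann g ![q, l, a, k] y := by
      intro q a
      have b := hg.riemann_bianchi hy k l q a
      have e1 := hg.riemann_pair_symm hy q a k l
      have e2 := hg.riemann_pair_symm hy q k a l
      have e3 := hg.riemann_pair_symm hy q l a k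
      have e4 := hg.riemann_swap_snd hy l a q k
      have e5 := hg.riemann_swap_snd hy a k q l
      have e6 := hg.riemann_pair_symm hy l a q k
      have e7 := riemann_swap_fst g a l q k y
      have e8 := hg.riemann_swap_snd hy q k l a
      linarith
    rw [hg.sum_riemannUp_mul hy i j fun q a => riemann g ![q, a, k, l] y, hB, hB]
    simp only [hW, mul_sub, Finset.sum_sub_distrib]
  have hQ3 : ∑ p, ∑ q, inv g p q y * ∑ a, riemannUp g a p i k y * riemann g ![q, j, a, l] y
      = quadB g ![i, k, j, l] y :=
    hg.sum_riemannUp_mul hy i k fun q a => riemann g ![q, j, a, l] y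
  have hQ4 : ∑ p, ∑ q, inv g p q y * ∑ a, riemannUp g a p i l y * riemann g ![q, j, k, a] y
      = -quadB g ![i, l, j, k] y := by
    rw [hg.sum_riemannUp_mul hy i l fun q a => riemann g ![q, j, k, a] y, hB]
    simp only [fun q a => hg.riemann_swap_snd hy q j a k, mul_neg, Finset.sum_neg_distrib]
  simp only [hact, mul_add (inv g _ _ y), Finset.sum_add_distrib]
  rw [hQ1, hQ2, hQ3, hQ4]
  ring

/-- The divergence of the curvature, differentiated once more: the contracted second Bianchi
identity. -/
lemma sum_cov_cov_riemann (hy : y ∈ U) (i j k l : Fin n) :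
    ∑ p, ∑ q, inv g p q y * cov g (cov g (riemann g)) ![i, p, q, j, k, l] y
      = cov g (cov g (ricci g)) ![i, k, l, j] y - cov g (cov g (ricci g)) ![i, l, k, j] y := by
  rw [hg.cov_cov_ricci hy, hg.cov_cov_ricci hy, ← Finset.sum_sub_distrib]
  refine Finset.sum_congr rfl fun p _ => ?_
  rw [← Finset.sum_sub_distrib]
  refine Finset.sum_congr rfl fun q _ => ?_
  have h1 := hg.cov_cov_riemann_pair_symm hy i p k l q j
  have h2 := hg.cov_cov_riemann_bianchi hy i p k l q j
  have h3 := hg.cov_cov_riemann_swap_fst hy i k p l q j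
  rw [h1, ← mul_sub]
  congr 1
  linarith

/-- Hamilton's formula for the Laplacian of the curvature. -/
lemma laplacian_riemann (hy : y ∈ U) (i j k l : Fin n) :
    laplacian g (riemann g) ![i, j, k, l] y
      + 2 * (quadB g ![i, j, k, l] y - quadB g ![i, j, l, k] y
        - quadB g ![i, l, j, k] y + quadB g ![i, k, j, l] y)
      = cov g (cov g (ricci g)) ![i, k, l, j] y - cov g (cov g (ricci g)) ![i, l, k, j] y
        - cov g (cov g (ricci g)) ![j, k, l, i] y + cov g (cov g (ricci g)) ![j, l, k, i] y
        + ∑ p, ∑ q, inv g p q y * (riemann g ![p, j, k, l] y * ricci g ![q, i] y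
          + riemann g ![i, p, k, l] y * ricci g ![q, j] y) := by
  have hX : ∀ i j, ∑ p, ∑ q, inv g p q y * cov g (cov g (riemann g)) ![p, i, q, j, k, l] y
      = ∑ p, ∑ q, inv g p q y * cov g (cov g (riemann g)) ![i, p, q, j, k, l] y
        - ∑ p, ∑ q, inv g p q y *
          act (curvMatrix g p i y) (fun J => riemann g J y) ![q, j, k, l] := by
    intro i j
    rw [← Finset.sum_sub_distrib]
    refine Finset.sum_congr rfl fun p _ => ?_
    rw [← Finset.sum_sub_distrib]
    refine Finset.sum_congr rfl fun q _ => ?_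
    have := cov_cov_commutator hg hg.smooth_riemann hy p i ![q, j, k, l]
    rw [← mul_sub]
    congr 1
    linarith
  have hL : laplacian g (riemann g) ![i, j, k, l] y
      = ∑ p, ∑ q, inv g p q y * cov g (cov g (riemann g)) ![p, i, q, j, k, l] y
        - ∑ p, ∑ q, inv g p q y * cov g (cov g (riemann g)) ![p, j, q, i, k, l] y := by
    rw [← Finset.sum_sub_distrib]
    refine Finset.sum_congr rfl fun p _ => ?_
    rw [← Finset.sum_sub_distrib]
    refine Finset.sum_congr rfl fun q _ => ?_
    have h1 := hg.cov_cov_riemann_bianchi hy p q i j k l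
    have h2 := hg.cov_cov_riemann_swap_fst hy p i q j k l
    rw [← mul_sub]
    congr 1
    change cov g (cov g (riemann g)) ![p, q, i, j, k, l] y = _
    linarith
  rw [hL, hX i j, hX j i, hg.sum_cov_cov_riemann hy, hg.sum_cov_cov_riemann hy,
    hg.sum_act_curvMatrix hy, hg.sum_act_curvMatrix hy, hg.quadB_symm hy i j l k,
    hg.quadB_symm hy i j k l, hg.quadB_pair_symm hy i l j k, hg.quadB_pair_symm hy i k j l]
  have hswap : ∑ p, ∑ q, inv g p q y * (riemann g ![p, i, k, l] y * ricci g ![q, j] y)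
      = -∑ p, ∑ q, inv g p q y * (riemann g ![i, p, k, l] y * ricci g ![q, j] y) := by
    simp only [fun p => riemann_swap_fst g i p k l y, neg_mul, mul_neg, Finset.sum_neg_distrib]
  simp only [mul_add (inv g _ _ y), Finset.sum_add_distrib]
  rw [hswap]
  ring

end IsMetricOn

/-! ### Time-dependent functions -/

/-- A time-dependent function of the coordinates that is smooth in time and space, with one-sided
time derivatives at `0`. -/
def SmoothInTime (T : ℝ) (U : Set (EuclideanSpace ℝ (Fin n)))
    (f : ℝ → EuclideanSpace ℝ (Fin n) → ℝ) : Prop :=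
  ContDiffOn ℝ ∞ (fun p : ℝ × EuclideanSpace ℝ (Fin n) => f p.1 p.2) (Set.Ico 0 T ×ˢ U)

/-- The time derivative within `[0, T)`. -/
def timeDeriv (T : ℝ) (f : ℝ → EuclideanSpace ℝ (Fin n) → ℝ) (t : ℝ)
    (y : EuclideanSpace ℝ (Fin n)) : ℝ :=
  derivWithin (fun s => f s y) (Set.Ico 0 T) t

lemma uniqueDiffOn_spaceTime (T : ℝ) {U : Set (EuclideanSpace ℝ (Fin n))} (hU : IsOpen U) :
    UniqueDiffOn ℝ (Set.Ico 0 T ×ˢ U) :=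
  (uniqueDiffOn_Ico 0 T).prod hU.uniqueDiffOn

namespace SmoothInTime
variable {T : ℝ} {U : Set (EuclideanSpace ℝ (Fin n))} {f : ℝ → EuclideanSpace ℝ (Fin n) → ℝ}
  (hf : SmoothInTime T U f) {t : ℝ} {y : EuclideanSpace ℝ (Fin n)}
include hf

lemma hasFDerivWithinAt (ht : t ∈ Set.Ico 0 T) (hy : y ∈ U) :
    HasFDerivWithinAt (fun p : ℝ × EuclideanSpace ℝ (Fin n) => f p.1 p.2)
      (fderivWithin ℝ (fun p : ℝ × EuclideanSpace ℝ (Fin n) => f p.1 p.2) (Set.Ico 0 T ×ˢ U) (t, y))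
      (Set.Ico 0 T ×ˢ U) (t, y) :=
  (hf.differentiableOn (by simp) (t, y) ⟨ht, hy⟩).hasFDerivWithinAt

lemma smooth_slice (ht : t ∈ Set.Ico 0 T) : ContDiffOn ℝ ∞ (f t) U :=
  hf.comp (f := fun z => (t, z)) (contDiffOn_const.prodMk contDiffOn_id) fun _ hz => ⟨ht, hz⟩

lemma hasDerivWithinAt_fderivWithin (ht : t ∈ Set.Ico 0 T) (hy : y ∈ U) :
    HasDerivWithinAt (fun s => f s y)
      (fderivWithin ℝ (fun p : ℝ × EuclideanSpace ℝ (Fin n) => f p.1 p.2) (Set.Ico 0 T ×ˢ U) (t, y)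
        (1, 0)) (Set.Ico 0 T) t :=
  (hf.hasFDerivWithinAt ht hy).comp_hasDerivWithinAt t (f := fun s => (s, y))
    ((hasDerivWithinAt_id t _).prodMk (hasDerivWithinAt_const t _ y)) fun _ hs => ⟨hs, hy⟩

lemma timeDeriv_eq (ht : t ∈ Set.Ico 0 T) (hy : y ∈ U) :
    timeDeriv T f t y = fderivWithin ℝ (fun p : ℝ × EuclideanSpace ℝ (Fin n) => f p.1 p.2)
      (Set.Ico 0 T ×ˢ U) (t, y) (1, 0) :=
  (hf.hasDerivWithinAt_fderivWithin ht hy).derivWithin (uniqueDiffOn_Ico 0 T t ht)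

lemma hasDerivWithinAt (ht : t ∈ Set.Ico 0 T) (hy : y ∈ U) :
    HasDerivWithinAt (fun s => f s y) (timeDeriv T f t y) (Set.Ico 0 T) t := by
  rw [hf.timeDeriv_eq ht hy]
  exact hf.hasDerivWithinAt_fderivWithin ht hy

lemma partialDeriv_eq (hU : IsOpen U) (ht : t ∈ Set.Ico 0 T) (hy : y ∈ U) (i : Fin n) :
    partialDeriv i (f t) y = fderivWithin ℝ (fun p : ℝ × EuclideanSpace ℝ (Fin n) => f p.1 p.2)
      (Set.Ico 0 T ×ˢ U) (t, y) (0, EuclideanSpace.single i 1) := by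
  have h := ((hf.hasFDerivWithinAt ht hy).comp y (f := fun z => (t, z))
    ((hasFDerivWithinAt_const t y U).prodMk (hasFDerivWithinAt_id y U))
      fun _ hz => ⟨ht, hz⟩).hasFDerivAt (hU.mem_nhds hy)
  have h' := h.fderiv
  change fderiv ℝ (f t) y = _ at h'
  rw [partialDeriv, h']
  rfl

lemma smooth_fderivWithin (hU : IsOpen U) : ContDiffOn ℝ ∞
    (fderivWithin ℝ (fun p : ℝ × EuclideanSpace ℝ (Fin n) => f p.1 p.2) (Set.Ico 0 T ×ˢ U))
    (Set.Ico 0 T ×ˢ U) :=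
  ContDiffOn.fderivWithin hf (uniqueDiffOn_spaceTime T hU) (by simp)

lemma partialDeriv (hU : IsOpen U) (i : Fin n) :
    SmoothInTime T U fun s => GenRicciFlow.partialDeriv i (f s) :=
  ((hf.smooth_fderivWithin hU).clm_apply
    (contDiffOn_const (c := ((0 : ℝ), EuclideanSpace.single i (1 : ℝ))))).congr
    fun _ hp => hf.partialDeriv_eq hU hp.1 hp.2 i

lemma timeDeriv (hU : IsOpen U) : SmoothInTime T U (GenRicciFlow.timeDeriv T f) :=
  ((hf.smooth_fderivWithin hU).clm_apply
    (contDiffOn_const (c := ((1 : ℝ), (0 : EuclideanSpace ℝ (Fin n)))))).congr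
    fun _ hp => hf.timeDeriv_eq hp.1 hp.2

/-- Time and space derivatives commute, also at the boundary time `0`. -/
lemma timeDeriv_partialDeriv (hU : IsOpen U) (ht : t ∈ Set.Ico 0 T) (hy : y ∈ U) (i : Fin n) :
    GenRicciFlow.timeDeriv T (fun s => GenRicciFlow.partialDeriv i (f s)) t y
      = GenRicciFlow.partialDeriv i (GenRicciFlow.timeDeriv T f t) y := by
  set F : ℝ × EuclideanSpace ℝ (Fin n) → ℝ := fun p => f p.1 p.2 with hF
  set S : Set (ℝ × EuclideanSpace ℝ (Fin n)) := Set.Ico 0 T ×ˢ U with hS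
  have hSu : UniqueDiffOn ℝ S := uniqueDiffOn_spaceTime T hU
  have hx : (t, y) ∈ S := ⟨ht, hy⟩
  have hD : HasFDerivWithinAt (fderivWithin ℝ F S) (fderivWithin ℝ (fderivWithin ℝ F S) S (t, y))
      S (t, y) :=
    ((hf.smooth_fderivWithin hU).differentiableOn (by simp) _ hx).hasFDerivWithinAt
  have hT : (0 : ℝ) < T := ht.1.trans_lt ht.2
  have hcl : (t, y) ∈ closure (interior S) := by
    rw [hS, interior_prod_eq, interior_Ico, hU.interior_eq, closure_prod_eq,
      closure_Ioo hT.ne]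
    exact ⟨⟨ht.1, ht.2.le⟩, subset_closure hy⟩
  have hsymm : IsSymmSndFDerivWithinAt ℝ F S (t, y) :=
    ContDiffWithinAt.isSymmSndFDerivWithinAt (hf _ hx) (by
      rw [minSmoothness_of_isRCLikeNormedField]
      exact WithTop.coe_le_coe.2 (le_top : (2 : ℕ∞) ≤ ⊤)) hSu hcl hx
  -- Both sides are the second derivative of `F`, with the two directions in either order.
  have key : ∀ v : ℝ × EuclideanSpace ℝ (Fin n), HasFDerivWithinAt
      (fun p => fderivWithin ℝ F S p v)
      ((fderivWithin ℝ (fderivWithin ℝ F S) S (t, y)).flip v) S (t, y) := by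
    intro v
    have h := hD.clm_apply (hasFDerivWithinAt_const v (t, y) S)
    rw [ContinuousLinearMap.comp_zero, zero_add] at h
    exact h
  have h1 : SmoothInTime T U fun s => GenRicciFlow.partialDeriv i (f s) := hf.partialDeriv hU i
  rw [h1.timeDeriv_eq ht hy, (hf.timeDeriv hU).partialDeriv_eq hU ht hy]
  have e1 : ∀ p ∈ S, GenRicciFlow.partialDeriv i (f p.1) p.2
      = fderivWithin ℝ F S p (0, EuclideanSpace.single i 1) :=
    fun p hp => hf.partialDeriv_eq hU hp.1 hp.2 i
  have e2 : ∀ p ∈ S, GenRicciFlow.timeDeriv T f p.1 p.2 = fderivWithin ℝ F S p (1, 0) :=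
    fun p hp => hf.timeDeriv_eq hp.1 hp.2
  rw [fderivWithin_congr e1 (e1 _ hx), fderivWithin_congr e2 (e2 _ hx),
    (key _).fderivWithin (hSu _ hx), (key _).fderivWithin (hSu _ hx)]
  exact hsymm.eq _ _

lemma hasDerivWithinAt_partialDeriv (hU : IsOpen U) (ht : t ∈ Set.Ico 0 T) (hy : y ∈ U)
    (i : Fin n) :
    HasDerivWithinAt (fun s => GenRicciFlow.partialDeriv i (f s) y)
      (GenRicciFlow.partialDeriv i (GenRicciFlow.timeDeriv T f t) y) (Set.Ico 0 T) t := by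
  rw [← hf.timeDeriv_partialDeriv hU ht hy]
  exact (hf.partialDeriv hU i).hasDerivWithinAt ht hy

end SmoothInTime

/-! ### Variation of the curvature -/

section Variation
variable {T : ℝ} {U : Set (EuclideanSpace ℝ (Fin n))} {g : ℝ → Tensor n 2}

/-- The tensor `∂_t g`. -/
def metricDeriv (T : ℝ) (g : ℝ → Tensor n 2) (t : ℝ) : Tensor n 2 := fun I =>
  timeDeriv T (fun s => g s I) t

/-- The matrix of the `∂_t Γ^k_{il}`, with row index `k` and column index `l`. -/
def connDeriv (T : ℝ) (g : ℝ → Tensor n 2) (t : ℝ) (i : Fin n) (y : EuclideanSpace ℝ (Fin n)) :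
    Matrix (Fin n) (Fin n) ℝ :=
  Matrix.of fun k l => timeDeriv T (fun s => christoffel (g s) k i l) t y

/-- The tensor `g_{kp} ∂_t Γ^p_{jl}`, with indices in the order `j, k, l`. -/
def lowerConnDeriv (T : ℝ) (g : ℝ → Tensor n 2) (t : ℝ) : Tensor n 3 := fun I y =>
  (metricMatrix (g t) y * connDeriv T g t (I 0) y) (I 1) (I 2)

variable (hg : ∀ t ∈ Set.Ico 0 T, IsMetricOn (g t) U) (hU : IsOpen U)
  (hs : ∀ I, SmoothInTime T U fun t => g t I)
include hg hU hs

lemma smoothInTime_christoffel (k i j : Fin n) :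
    SmoothInTime T U fun t => christoffel (g t) k i j := by
  have hinv : ∀ a b, SmoothInTime T U fun t => inv (g t) a b := fun a b =>
    contDiffOn_matrix_inv
      (m := fun p : ℝ × EuclideanSpace ℝ (Fin n) => metricMatrix (g p.1) p.2)
      (fun a b => hs ![a, b]) (fun p hp => (hg p.1 hp.1).det_ne_zero p.2 hp.2) a b
  have hd : ∀ m I, SmoothInTime T U fun t => partialDeriv m (g t I) := fun m I =>
    (hs I).partialDeriv hU m
  exact contDiffOn_const.mul <| ContDiffOn.sum fun l _ => ContDiffOn.mul (hinv k l) <|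
    ContDiffOn.sub (ContDiffOn.add (hd i ![j, l]) (hd j ![i, l])) (hd l ![i, j])

variable {t : ℝ} (ht : t ∈ Set.Ico 0 T) {y : EuclideanSpace ℝ (Fin n)} (hy : y ∈ U)
include ht

omit hg in
lemma smooth_metricDeriv (I : Fin 2 → Fin n) : ContDiffOn ℝ ∞ (metricDeriv T g t I) U :=
  ((hs I).timeDeriv hU).smooth_slice ht

lemma smooth_connDeriv (i a b : Fin n) : ContDiffOn ℝ ∞ (fun z => connDeriv T g t i z a b) U :=
  ((smoothInTime_christoffel hg hU hs a i b).timeDeriv hU).smooth_slice ht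

include hy

omit hU hs in
lemma metricDeriv_symm (i j : Fin n) :
    metricDeriv T g t ![i, j] y = metricDeriv T g t ![j, i] y :=
  derivWithin_congr (fun s hs' => (hg s hs').symm y hy i j) ((hg t ht).symm y hy i j)

/-- The time derivative of the Christoffel symbols of the first kind. -/
lemma metricDeriv_mul_connMatrix (i k l : Fin n) :
    (metricMatrix (metricDeriv T g t) y * connMatrix (g t) i y) k l
        + (metricMatrix (g t) y * connDeriv T g t i y) k l
      = (1 / 2) * (partialDeriv i (metricDeriv T g t ![l, k]) y
        + partialDeriv l (metricDeriv T g t ![i, k]) y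
        - partialDeriv k (metricDeriv T g t ![i, l]) y) := by
  have h1 : HasDerivWithinAt (fun s => (metricMatrix (g s) y * connMatrix (g s) i y) k l)
      ((metricMatrix (metricDeriv T g t) y * connMatrix (g t) i y) k l
        + (metricMatrix (g t) y * connDeriv T g t i y) k l) (Set.Ico 0 T) t := by
    simp only [Matrix.mul_apply, ← Finset.sum_add_distrib]
    exact HasDerivWithinAt.fun_sum fun p _ => ((hs ![k, p]).hasDerivWithinAt ht hy).mul
      ((smoothInTime_christoffel hg hU hs p i l).hasDerivWithinAt ht hy)
  have hd : ∀ m I, HasDerivWithinAt (fun s => partialDeriv m (g s I) y)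
      (partialDeriv m (metricDeriv T g t I) y) (Set.Ico 0 T) t := fun m I =>
    (hs I).hasDerivWithinAt_partialDeriv hU ht hy m
  have h2 : HasDerivWithinAt (fun s => (metricMatrix (g s) y * connMatrix (g s) i y) k l)
      ((1 / 2) * (partialDeriv i (metricDeriv T g t ![l, k]) y
        + partialDeriv l (metricDeriv T g t ![i, k]) y
        - partialDeriv k (metricDeriv T g t ![i, l]) y)) (Set.Ico 0 T) t := by
    refine HasDerivWithinAt.congr ((((hd i ![l, k]).add (hd l ![i, k])).sub
      (hd k ![i, l])).const_mul (1 / 2)) (fun s hs' => ?_) ?_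
    · exact (hg s hs').metricMatrix_mul_connMatrix hy i k l
    · exact (hg t ht).metricMatrix_mul_connMatrix hy i k l
  exact (uniqueDiffOn_Ico 0 T t ht).eq_deriv _ h1 h2

/-- The variation of the connection:
`g_{kp} ∂_t Γ^p_{jl} = ½ (∇_j h_{lk} + ∇_l h_{kj} - ∇_k h_{jl})` with `h = ∂_t g`. -/
lemma lowerConnDeriv_eq (I : Fin 3 → Fin n) :
    lowerConnDeriv T g t I y
      = (1 / 2) * (cov (g t) (metricDeriv T g t) ![I 0, I 2, I 1] y
        + cov (g t) (metricDeriv T g t) ![I 2, I 1, I 0] y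
        - cov (g t) (metricDeriv T g t) ![I 1, I 0, I 2] y) := by
  have h := metricDeriv_mul_connMatrix hg hU hs ht hy (I 0) (I 1) (I 2)
  have hsym : ∀ i j, metricDeriv T g t ![i, j] y = metricDeriv T g t ![j, i] y :=
    metricDeriv_symm hg ht hy
  have hΓ : ∀ k i j, christoffel (g t) k i j y = christoffel (g t) k j i y :=
    (hg t ht).christoffel_symm hy
  have hp : partialDeriv (I 2) (metricDeriv T g t ![I 1, I 0]) y
      = partialDeriv (I 2) (metricDeriv T g t ![I 0, I 1]) y :=
    partialDeriv_congr_on hU (fun z hz => metricDeriv_symm hg ht hz (I 1) (I 0)) (I 2) hy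
  rw [Matrix.mul_apply] at h
  change ∑ p, metricDeriv T g t ![I 1, p] y * christoffel (g t) p (I 0) (I 2) y
    + lowerConnDeriv T g t I y = _ at h
  rw [eq_sub_of_add_eq' h]
  simp only [cov_cons, act_cons, act_empty, connMatrix, Matrix.of_apply, hp]
  simp only [hΓ _ (I 2) (I 0), hΓ _ (I 1) (I 0), hΓ _ (I 2) (I 1), fun p => hsym p (I 1),
    fun p => hsym p (I 0), fun p => hsym p (I 2), mul_comm (christoffel _ _ _ _ _)]
  ring

lemma cov_lowerConnDeriv (i j k l : Fin n) :
    cov (g t) (lowerConnDeriv T g t) ![i, j, k, l] y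
      = (1 / 2) * (cov (g t) (cov (g t) (metricDeriv T g t)) ![i, j, l, k] y
        + cov (g t) (cov (g t) (metricDeriv T g t)) ![i, l, k, j] y
        - cov (g t) (cov (g t) (metricDeriv T g t)) ![i, k, j, l] y) := by
  set D := cov (g t) (metricDeriv T g t) with hD
  have hd : ∀ I, DifferentiableAt ℝ (D I) y := fun I => differentiableAt_of_smoothOn hU
    (smooth_cov (hg t ht) (smooth_metricDeriv hU hs ht) I) hy
  set σ : Equiv.Perm (Fin 3) := Equiv.swap 1 2
  set τ : Equiv.Perm (Fin 3) := Equiv.swap 0 2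
  set ρ : Equiv.Perm (Fin 3) := Equiv.swap 0 1
  have h1 : ∀ z ∈ U, ∀ I, lowerConnDeriv T g t I z
      = (1 / 2) * ((permSlots σ D I z + permSlots τ D I z) + (-1) * permSlots ρ D I z) := by
    intro z hz I
    have e1 : I ∘ σ = ![I 0, I 2, I 1] := by funext s; fin_cases s <;> rfl
    have e2 : I ∘ τ = ![I 2, I 1, I 0] := by funext s; fin_cases s <;> rfl
    have e3 : I ∘ ρ = ![I 1, I 0, I 2] := by funext s; fin_cases s <;> rfl
    rw [lowerConnDeriv_eq hg hU hs ht hz, permSlots, permSlots, permSlots, e1, e2, e3]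
    ring
  rw [cov_congr_on hU (g t) h1 y hy,
    cov_const_mul (g t) (1 / 2)
      (S := fun I z => (permSlots σ D I z + permSlots τ D I z) + (-1) * permSlots ρ D I z)
      (fun I => ((hd (I ∘ σ)).add (hd (I ∘ τ))).add ((hd (I ∘ ρ)).const_mul (-1))),
    cov_add (g t) (S := fun I z => permSlots σ D I z + permSlots τ D I z)
      (S' := fun I z => (-1) * permSlots ρ D I z)
      (fun I => (hd (I ∘ σ)).add (hd (I ∘ τ))) (fun I => (hd (I ∘ ρ)).const_mul (-1)),
    cov_add (g t) (S := permSlots σ D) (S' := permSlots τ D) (fun I => hd (I ∘ σ))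
      (fun I => hd (I ∘ τ)),
    cov_const_mul (g t) (-1) (S := permSlots ρ D) (fun I => hd (I ∘ ρ)),
    cov_permSlots, cov_permSlots, cov_permSlots, permSlots, permSlots, permSlots]
  have e1 : ![i, j, k, l] ∘ liftPerm σ = ![i, j, l, k] := by funext s; fin_cases s <;> rfl
  have e2 : ![i, j, k, l] ∘ liftPerm τ = ![i, l, k, j] := by funext s; fin_cases s <;> rfl
  have e3 : ![i, j, k, l] ∘ liftPerm ρ = ![i, k, j, l] := by funext s; fin_cases s <;> rfl
  rw [e1, e2, e3]
  ring

/-- The time derivative of the curvature matrix, as the exterior covariant derivative of that of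
the connection matrix. -/
lemma hasDerivWithinAt_riemannUp (k i j l : Fin n) :
    HasDerivWithinAt (fun s => riemannUp (g s) k i j l y)
      ((matrixDeriv i (connDeriv T g t j) y - matrixDeriv j (connDeriv T g t i) y
        + ((connDeriv T g t i y * connMatrix (g t) j y + connMatrix (g t) i y * connDeriv T g t j y)
          - (connDeriv T g t j y * connMatrix (g t) i y
            + connMatrix (g t) j y * connDeriv T g t i y))) k l) (Set.Ico 0 T) t := by
  have hΓ := smoothInTime_christoffel hg hU hs
  have hd : ∀ k i j, HasDerivWithinAt (fun s => christoffel (g s) k i j y)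
      (connDeriv T g t i y k j) (Set.Ico 0 T) t := fun k i j => (hΓ k i j).hasDerivWithinAt ht hy
  have h := (((hΓ k j l).hasDerivWithinAt_partialDeriv hU ht hy i).sub
    ((hΓ k i l).hasDerivWithinAt_partialDeriv hU ht hy j)).add
    (HasDerivWithinAt.fun_sum (u := Finset.univ) fun p _ =>
      ((hd k i p).mul (hd p j l)).sub ((hd k j p).mul (hd p i l)))
  refine h.congr_deriv ?_
  simp only [Matrix.add_apply, Matrix.sub_apply, Matrix.mul_apply, Finset.sum_add_distrib,
    Finset.sum_sub_distrib]
  rfl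

lemma cov_lowerConnDeriv_sub (i j k l : Fin n) :
    cov (g t) (lowerConnDeriv T g t) ![i, j, k, l] y
        - cov (g t) (lowerConnDeriv T g t) ![j, i, k, l] y
      = (metricMatrix (g t) y *
        (matrixDeriv i (connDeriv T g t j) y - matrixDeriv j (connDeriv T g t i) y
        + ((connDeriv T g t i y * connMatrix (g t) j y + connMatrix (g t) i y * connDeriv T g t j y)
          - (connDeriv T g t j y * connMatrix (g t) i y
            + connMatrix (g t) j y * connDeriv T g t i y)))) k l := by
  have key : ∀ i j, cov (g t) (lowerConnDeriv T g t) ![i, j, k, l] y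
      = (metricMatrix (g t) y * (matrixDeriv i (connDeriv T g t j) y
          + connMatrix (g t) i y * connDeriv T g t j y
          - connDeriv T g t j y * connMatrix (g t) i y)) k l
        - ∑ p, christoffel (g t) p i j y * lowerConnDeriv T g t ![p, k, l] y := by
    intro i j
    have h1 : partialDeriv i (lowerConnDeriv T g t ![j, k, l]) y
        = (matrixDeriv i (fun z => metricMatrix (g t) z * connDeriv T g t j z) y) k l := rfl
    rw [matrixDeriv_mul (m := metricMatrix (g t)) (m' := connDeriv T g t j)
      (fun a b => differentiableAt_of_smoothOn hU ((hg t ht).smooth ![a, b]) hy)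
      (fun a b => differentiableAt_of_smoothOn hU (smooth_connDeriv hg hU hs ht j a b) hy),
      (hg t ht).matrixDeriv_metricMatrix hy] at h1
    have h3 : ∑ p, connMatrix (g t) i y p k * lowerConnDeriv T g t ![j, p, l] y
        = ((connMatrix (g t) i y).transpose * (metricMatrix (g t) y * connDeriv T g t j y)) k l := by
      rw [Matrix.mul_apply]; rfl
    have h4 : ∑ p, connMatrix (g t) i y p l * lowerConnDeriv T g t ![j, k, p] y
        = ((metricMatrix (g t) y * connDeriv T g t j y) * connMatrix (g t) i y) k l := by
      rw [Matrix.mul_apply]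
      exact Finset.sum_congr rfl fun p _ => mul_comm _ _
    rw [cov_cons, act_cons, act_cons, act_cons, act_empty, h1, h3, h4]
    simp only [connMatrix, Matrix.of_apply, Matrix.mul_add, Matrix.mul_sub, Matrix.add_mul,
      Matrix.mul_assoc, Matrix.add_apply, Matrix.sub_apply]
    ring
  rw [key i j, key j i]
  simp only [(hg t ht).christoffel_symm hy _ j i, Matrix.mul_add, Matrix.mul_sub,
    Matrix.add_apply, Matrix.sub_apply]
  ring

/-- The variation formula for the curvature tensor, with `h = ∂_t g`. -/
lemma hasDerivWithinAt_riemann (i j k l : Fin n) :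
    HasDerivWithinAt (fun s => riemann (g s) ![i, j, k, l] y)
      ((1 / 2) * (cov (g t) (cov (g t) (metricDeriv T g t)) ![i, l, k, j] y
          - cov (g t) (cov (g t) (metricDeriv T g t)) ![i, k, j, l] y
          - cov (g t) (cov (g t) (metricDeriv T g t)) ![j, l, k, i] y
          + cov (g t) (cov (g t) (metricDeriv T g t)) ![j, k, i, l] y)
        + (1 / 2) * ∑ m, ∑ q, inv (g t) m q y *
          (metricDeriv T g t ![k, m] y * riemann (g t) ![i, j, q, l] y
            + metricDeriv T g t ![m, l] y * riemann (g t) ![i, j, k, q] y))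
      (Set.Ico 0 T) t := by
  set h := metricDeriv T g t with hh
  have hsym : ∀ i j, h ![i, j] y = h ![j, i] y := metricDeriv_symm hg ht hy
  have hd : HasDerivWithinAt (fun s => riemann (g s) ![i, j, k, l] y)
      (∑ p, h ![k, p] y * riemannUp (g t) p i j l y
        + (cov (g t) (lowerConnDeriv T g t) ![i, j, k, l] y
          - cov (g t) (lowerConnDeriv T g t) ![j, i, k, l] y)) (Set.Ico 0 T) t := by
    rw [cov_lowerConnDeriv_sub hg hU hs ht hy, Matrix.mul_apply, ← Finset.sum_add_distrib]
    exact HasDerivWithinAt.fun_sum fun p _ => ((hs ![k, p]).hasDerivWithinAt ht hy).mul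
      (hasDerivWithinAt_riemannUp hg hU hs ht hy p i j l)
  refine hd.congr_deriv ?_
  have hcomm := cov_cov_commutator (hg t ht) (smooth_metricDeriv hU hs ht) hy i j ![l, k]
  rw [act_cons, act_cons, act_empty] at hcomm
  simp only [curvMatrix, Matrix.of_apply, ← hh] at hcomm
  have hc1 : ∑ p, riemannUp (g t) p i j l y * h ![p, k] y
      = ∑ p, h ![k, p] y * riemannUp (g t) p i j l y :=
    Finset.sum_congr rfl fun p _ => by rw [hsym p k, mul_comm]
  have hsum1 : ∑ m, ∑ q, inv (g t) m q y * (h ![k, m] y * riemann (g t) ![i, j, q, l] y)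
      = ∑ p, h ![k, p] y * riemannUp (g t) p i j l y := by
    simp only [(hg t ht).riemannUp_eq hy, Finset.mul_sum]
    exact Finset.sum_congr rfl fun _ _ => Finset.sum_congr rfl fun _ _ => by ring
  have hsum2 : ∑ m, ∑ q, inv (g t) m q y * (h ![m, l] y * riemann (g t) ![i, j, k, q] y)
      = -∑ p, riemannUp (g t) p i j k y * h ![l, p] y := by
    simp only [(hg t ht).riemannUp_eq hy, Finset.sum_mul, ← Finset.sum_neg_distrib]
    refine Finset.sum_congr rfl fun m _ => Finset.sum_congr rfl fun q _ => ?_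
    rw [(hg t ht).riemann_swap_snd hy i j q k, hsym m l]
    ring
  rw [cov_lowerConnDeriv hg hU hs ht hy, cov_lowerConnDeriv hg hU hs ht hy]
  simp only [mul_add (inv _ _ _ y), Finset.sum_add_distrib]
  rw [hsum1, hsum2]
  rw [hc1] at hcomm
  change cov (g t) (cov (g t) h) ![i, j, l, k] y - cov (g t) (cov (g t) h) ![j, i, l, k] y = _
    at hcomm
  linarith

end Variation

/-! ### The curvature under the generalized Ricci flow -/

lemma IsMetricOn.cov_cov_ricci_symm {g : Tensor n 2} {U : Set (EuclideanSpace ℝ (Fin n))}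
    (hg : IsMetricOn g U) {y : EuclideanSpace ℝ (Fin n)} (hy : y ∈ U) (a b i j : Fin n) :
    cov g (cov g (ricci g)) ![a, b, j, i] y = cov g (cov g (ricci g)) ![a, b, i, j] y := by
  have h0 : ∀ z ∈ U, ∀ I, ricci g (I ∘ Equiv.swap (0 : Fin 2) 1) z = 1 * ricci g I z := by
    intro z hz I
    have e1 : I = ![I 0, I 1] := by funext s; fin_cases s <;> rfl
    have e2 : I ∘ Equiv.swap (0 : Fin 2) 1 = ![I 1, I 0] := by funext s; fin_cases s <;> rfl
    rw [e2, hg.ricci_symm hz, ← e1, one_mul]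
  have h2 := hg.cov_of_perm_eq (smooth_cov hg hg.smooth_ricci)
    (fun z hz I => hg.cov_of_perm_eq hg.smooth_ricci h0 hz I) hy ![a, b, i, j]
  rw [one_mul] at h2
  rw [← h2]
  congr 1
  funext s; fin_cases s <;> rfl

lemma smooth_fieldF {U : Set (EuclideanSpace ℝ (Fin n))} (hU : IsOpen U) {A : Tensor n 1}
    (hA : ∀ I, ContDiffOn ℝ ∞ (A I) U) (I : Fin 2 → Fin n) :
    ContDiffOn ℝ ∞ (fieldF A I) U :=
  (contDiffOn_partialDeriv hU (hA _) _).sub (contDiffOn_partialDeriv hU (hA _) _)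

lemma smooth_fieldH {U : Set (EuclideanSpace ℝ (Fin n))} (hU : IsOpen U) {B : Tensor n 2}
    (hB : ∀ I, ContDiffOn ℝ ∞ (B I) U) (I : Fin 3 → Fin n) :
    ContDiffOn ℝ ∞ (fieldH B I) U :=
  ((contDiffOn_partialDeriv hU (hB _) _).add (contDiffOn_partialDeriv hU (hB _) _)).add
    (contDiffOn_partialDeriv hU (hB _) _)

lemma IsMetricOn.smooth_sqF {g : Tensor n 2} {U : Set (EuclideanSpace ℝ (Fin n))}
    (hg : IsMetricOn g U) {A : Tensor n 1} (hA : ∀ I, ContDiffOn ℝ ∞ (A I) U)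
    (I : Fin 2 → Fin n) : ContDiffOn ℝ ∞ (sqF g A I) U :=
  ContDiffOn.sum fun _ _ => ContDiffOn.sum fun _ _ =>
    ((hg.smooth_inv _ _).mul (smooth_fieldF hg.isOpen hA _)).mul (smooth_fieldF hg.isOpen hA _)

lemma IsMetricOn.smooth_sqH {g : Tensor n 2} {U : Set (EuclideanSpace ℝ (Fin n))}
    (hg : IsMetricOn g U) {B : Tensor n 2} (hB : ∀ I, ContDiffOn ℝ ∞ (B I) U)
    (I : Fin 2 → Fin n) : ContDiffOn ℝ ∞ (sqH g B I) U :=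
  ContDiffOn.sum fun _ _ => ContDiffOn.sum fun _ _ => ContDiffOn.sum fun _ _ =>
    ContDiffOn.sum fun _ _ => (((hg.smooth_inv _ _).mul (hg.smooth_inv _ _)).mul
      (smooth_fieldH hg.isOpen hB _)).mul (smooth_fieldH hg.isOpen hB _)

lemma cov_cov_linear_combination {g : Tensor n 2} {U : Set (EuclideanSpace ℝ (Fin n))}
    (hg : IsMetricOn g U) {h S S' S'' : Tensor n r} (a b c : ℝ)
    (hS : ∀ I, ContDiffOn ℝ ∞ (S I) U) (hS' : ∀ I, ContDiffOn ℝ ∞ (S' I) U)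
    (hS'' : ∀ I, ContDiffOn ℝ ∞ (S'' I) U)
    (hh : ∀ z ∈ U, ∀ I, h I z = a * S I z + b * S' I z + c * S'' I z)
    {y : EuclideanSpace ℝ (Fin n)} (hy : y ∈ U) (I : Fin (r + 2) → Fin n) :
    cov g (cov g h) I y
      = a * cov g (cov g S) I y + b * cov g (cov g S') I y + c * cov g (cov g S'') I y := by
  have key : ∀ {r : ℕ} {h S S' S'' : Tensor n r}, (∀ I, ContDiffOn ℝ ∞ (S I) U) →
      (∀ I, ContDiffOn ℝ ∞ (S' I) U) → (∀ I, ContDiffOn ℝ ∞ (S'' I) U) →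
      (∀ z ∈ U, ∀ I, h I z = a * S I z + b * S' I z + c * S'' I z) → ∀ z ∈ U, ∀ I,
      cov g h I z = a * cov g S I z + b * cov g S' I z + c * cov g S'' I z := by
    intro r h S S' S'' hS hS' hS'' hh z hz I
    have d : ∀ I, DifferentiableAt ℝ (S I) z := fun I =>
      differentiableAt_of_smoothOn hg.isOpen (hS I) hz
    have d' : ∀ I, DifferentiableAt ℝ (S' I) z := fun I =>
      differentiableAt_of_smoothOn hg.isOpen (hS' I) hz
    have d'' : ∀ I, DifferentiableAt ℝ (S'' I) z := fun I =>
      differentiableAt_of_smoothOn hg.isOpen (hS'' I) hz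
    rw [cov_congr_on hg.isOpen g hh z hz,
      cov_add g (S := fun I z => a * S I z + b * S' I z) (S' := fun I z => c * S'' I z)
        (fun I => ((d I).const_mul a).add ((d' I).const_mul b)) (fun I => (d'' I).const_mul c),
      cov_add g (S := fun I z => a * S I z) (S' := fun I z => b * S' I z)
        (fun I => (d I).const_mul a) (fun I => (d' I).const_mul b),
      cov_const_mul g a d, cov_const_mul g b d', cov_const_mul g c d'']
  exact key (smooth_cov hg hS) (smooth_cov hg hS') (smooth_cov hg hS'') (key hS hS' hS'' hh) y hy I

/-- For `h = -2 Ric + ½ hh + 2 ff`, the variation formula of the curvature is the right-hand side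
of its evolution equation. -/
lemma variation_eq_evolutionRHS {g : Tensor n 2} {U : Set (EuclideanSpace ℝ (Fin n))}
    (hg : IsMetricOn g U) {h hh ff : Tensor n 2} (hhs : ∀ I, ContDiffOn ℝ ∞ (hh I) U)
    (ffs : ∀ I, ContDiffOn ℝ ∞ (ff I) U)
    (hflow : ∀ z ∈ U, ∀ I, h I z = -2 * (ricci g I z - (1 / 4) * hh I z - ff I z))
    {y : EuclideanSpace ℝ (Fin n)} (hy : y ∈ U) (i j k l : Fin n) :
    (1 / 2) * (cov g (cov g h) ![i, l, k, j] y - cov g (cov g h) ![i, k, j, l] y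
          - cov g (cov g h) ![j, l, k, i] y + cov g (cov g h) ![j, k, i, l] y)
        + (1 / 2) * ∑ m, ∑ q, inv g m q y *
          (h ![k, m] y * riemann g ![i, j, q, l] y + h ![m, l] y * riemann g ![i, j, k, q] y)
      = evolutionRHS g hh ff i j k l y := by
  have hcc := cov_cov_linear_combination hg (-2) (1 / 2) 2 hg.smooth_ricci hhs ffs
    (h := h) (fun z hz I => by rw [hflow z hz]; ring) hy
  have hlap := hg.laplacian_riemann hy i j k l
  rw [hg.cov_cov_ricci_symm hy i k j l, hg.cov_cov_ricci_symm hy j k i l] at hlap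
  have hsum : ∑ m, ∑ q, inv g m q y *
        (h ![k, m] y * riemann g ![i, j, q, l] y + h ![m, l] y * riemann g ![i, j, k, q] y)
      = -2 * ∑ p, ∑ q, inv g p q y * (riemann g ![i, j, p, l] y * ricci g ![q, k] y
            + riemann g ![i, j, k, p] y * ricci g ![q, l] y)
        + (1 / 2) * ∑ m, ∑ q, inv g m q y *
          (hh ![k, m] y * riemann g ![i, j, q, l] y + hh ![m, l] y * riemann g ![i, j, k, q] y)
        + 2 * ∑ m, ∑ q, inv g m q y *
          (ff ![k, m] y * riemann g ![i, j, q, l] y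
            + ff ![m, l] y * riemann g ![i, j, k, q] y) := by
    rw [Finset.sum_comm (f := fun p q => inv g p q y * (riemann g ![i, j, p, l] y
      * ricci g ![q, k] y + riemann g ![i, j, k, p] y * ricci g ![q, l] y))]
    simp only [Finset.mul_sum, ← Finset.sum_add_distrib]
    refine Finset.sum_congr rfl fun m _ => Finset.sum_congr rfl fun q _ => ?_
    rw [hflow y hy, hflow y hy, hg.inv_symm hy q m, hg.ricci_symm hy k m]
    ring
  have hRic : ∑ p, ∑ q, inv g p q y *
        (riemann g ![p, j, k, l] y * ricci g ![q, i] y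
          + riemann g ![i, p, k, l] y * ricci g ![q, j] y
          + riemann g ![i, j, p, l] y * ricci g ![q, k] y
          + riemann g ![i, j, k, p] y * ricci g ![q, l] y)
      = ∑ p, ∑ q, inv g p q y * (riemann g ![p, j, k, l] y * ricci g ![q, i] y
          + riemann g ![i, p, k, l] y * ricci g ![q, j] y)
        + ∑ p, ∑ q, inv g p q y * (riemann g ![i, j, p, l] y * ricci g ![q, k] y
            + riemann g ![i, j, k, p] y * ricci g ![q, l] y) := by
    simp only [← Finset.sum_add_distrib]
    exact Finset.sum_congr rfl fun _ _ => Finset.sum_congr rfl fun _ _ => by ring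
  rw [evolutionRHS, hsum, hRic, hcc, hcc, hcc, hcc]
  linarith

/-! ### Components in a chart -/

section Chart
variable {M : Type*} [TopologicalSpace M] [ChartedSpace (EuclideanSpace ℝ (Fin n)) M]
  {φ : OpenPartialHomeomorph M (EuclideanSpace ℝ (Fin n))}

lemma mfderiv_chart_symm_injective (hφ : φ ∈ IsManifold.maximalAtlas (𝓡 n) ∞ M)
    {y : EuclideanSpace ℝ (Fin n)} (hy : y ∈ φ.target) :
    Function.Injective (mfderiv 𝓘(ℝ, EuclideanSpace ℝ (Fin n)) (𝓡 n) φ.symm y) := by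
  have h : φ.MDifferentiable (𝓡 n) (𝓡 n) :=
    ⟨(contMDiffOn_of_mem_maximalAtlas hφ).mdifferentiableOn (by simp),
      (contMDiffOn_symm_of_mem_maximalAtlas hφ).mdifferentiableOn (by simp)⟩
  exact h.symm.mfderiv_injective hy

/-- The matrix of a positive definite form in the coordinate frame is invertible: a vector in its
kernel gives a tangent vector of length zero. -/
lemma det_bilinComp_ne_zero (hφ : φ ∈ IsManifold.maximalAtlas (𝓡 n) ∞ M) {g : BilinField n M}
    {y : EuclideanSpace ℝ (Fin n)} (hy : y ∈ φ.target)
    (hpos : ∀ v : TangentSpace (𝓡 n) (φ.symm y), v ≠ 0 → 0 < g (φ.symm y) v v) :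
    (Matrix.of fun a b => bilinComp φ g ![a, b] y).det ≠ 0 := by
  intro hdet
  obtain ⟨v, hv, hMv⟩ := Matrix.exists_mulVec_eq_zero_iff.2 hdet
  set w : EuclideanSpace ℝ (Fin n) := ∑ a, v a • EuclideanSpace.single a (1 : ℝ) with hw
  have hwv : ∀ a, w a = v a := by
    intro a
    simp [hw, Finset.sum_apply, Pi.single_apply]
  have hw0 : w ≠ 0 := fun h => hv (funext fun a => by rw [← hwv a, h]; rfl)
  set D := mfderiv 𝓘(ℝ, EuclideanSpace ℝ (Fin n)) (𝓡 n) φ.symm y with hD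
  have hDw : D w = ∑ a, v a • coordVec φ a y := by
    rw [hw]
    exact (map_sum D _ _).trans (Finset.sum_congr rfl fun a _ => map_smul D _ _)
  have hDw0 : D w ≠ 0 := fun h => hw0
    (mfderiv_chart_symm_injective hφ hy (h.trans (map_zero D).symm))
  have hlen : g (φ.symm y) (D w) (D w) = 0 := by
    have hrow : ∀ a, ∑ b, g (φ.symm y) (coordVec φ a y) (coordVec φ b y) * v b = 0 := fun a =>
      congrFun hMv a
    have hrow' : ∀ a, g (φ.symm y) (coordVec φ a y) (D w) = 0 := by
      intro a
      rw [hDw, map_sum, ← hrow a]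
      exact Finset.sum_congr rfl fun b _ => by rw [map_smul, smul_eq_mul, mul_comm]
    have hleft : ∀ u, g (φ.symm y) (D w) u
        = ∑ a, v a * g (φ.symm y) (coordVec φ a y) u := fun u => by
      rw [hDw, map_sum, sum_apply]
      exact Finset.sum_congr rfl fun a _ => by rw [map_smul]; rfl
    rw [hleft]
    exact Finset.sum_eq_zero fun a _ => by rw [hrow' a, mul_zero]
  exact (hpos _ hDw0).ne' hlen

lemma IsSolution.isMetricOn {T : ℝ} {g : ℝ → BilinField n M} {A : ℝ → FormField n 1 M}
    {B : ℝ → FormField n 2 M} (h : IsSolution T g A B)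
    (hφ : φ ∈ IsManifold.maximalAtlas (𝓡 n) ∞ M) {t : ℝ} (ht : t ∈ Set.Ico 0 T) :
    IsMetricOn (bilinComp φ (g t)) φ.target where
  isOpen := φ.open_target
  smooth I := SmoothInTime.smooth_slice (f := fun t => bilinComp φ (g t) I)
    (h.smooth_g φ hφ I) ht
  symm _ _ _ _ := h.symm t ht _ _ _
  det_ne_zero _ hy := det_bilinComp_ne_zero hφ hy (h.pos t ht _)

end Chart
end GenRicciFlow
end

theorem theorem5p1 {n : ℕ} {M : Type*} [TopologicalSpace M]
    [ChartedSpace (EuclideanSpace ℝ (Fin n)) M] [IsManifold (𝓡 n) ∞ M]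
    (T : ℝ) (g : ℝ → GenRicciFlow.BilinField n M)
    (A : ℝ → GenRicciFlow.FormField n 1 M) (B : ℝ → GenRicciFlow.FormField n 2 M)
    (h : GenRicciFlow.IsSolution T g A B)
    (φ : OpenPartialHomeomorph M (EuclideanSpace ℝ (Fin n)))
    (hφ : φ ∈ IsManifold.maximalAtlas (𝓡 n) ∞ M)
    (t : ℝ) (ht : t ∈ Set.Ico 0 T) (y : EuclideanSpace ℝ (Fin n)) (hy : y ∈ φ.target)
    (i j k l : Fin n) :
    HasDerivWithinAt
      (fun s => GenRicciFlow.riemann (GenRicciFlow.bilinComp φ (g s)) ![i, j, k, l] y)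
      (GenRicciFlow.evolutionRHS (GenRicciFlow.bilinComp φ (g t))
        (GenRicciFlow.sqH (GenRicciFlow.bilinComp φ (g t)) (GenRicciFlow.formComp φ (B t)))
        (GenRicciFlow.sqF (GenRicciFlow.bilinComp φ (g t)) (GenRicciFlow.formComp φ (A t)))
        i j k l y)
      (Set.Ico 0 T) t := by
  have hmet : ∀ s ∈ Set.Ico 0 T,
      GenRicciFlow.IsMetricOn (GenRicciFlow.bilinComp φ (g s)) φ.target := fun _ hs => h.isMetricOn hφ hs
  have hA : ∀ I, ContDiffOn ℝ ∞ (GenRicciFlow.formComp φ (A t) I) φ.target := fun I =>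
    GenRicciFlow.SmoothInTime.smooth_slice (f := fun t => GenRicciFlow.formComp φ (A t) I)
      (h.smooth_A φ hφ I) ht
  have hB : ∀ I, ContDiffOn ℝ ∞ (GenRicciFlow.formComp φ (B t) I) φ.target := fun I =>
    GenRicciFlow.SmoothInTime.smooth_slice (f := fun t => GenRicciFlow.formComp φ (B t) I)
      (h.smooth_B φ hφ I) ht
  refine (GenRicciFlow.hasDerivWithinAt_riemann hmet φ.open_target (h.smooth_g φ hφ) ht hy
    i j k l).congr_deriv ?_
  refine GenRicciFlow.variation_eq_evolutionRHS (hmet t ht) ((hmet t ht).smooth_sqH hB)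
    ((hmet t ht).smooth_sqF hA) (fun z hz I => ?_) hy i j k l
  have hI : I = ![I 0, I 1] := by funext s; fin_cases s <;> rfl
  rw [hI]
  exact (h.flow_g φ hφ t ht z hz (I 0) (I 1)).derivWithin (uniqueDiffOn_Ico 0 T t ht)
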